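/- **Setting.** Let $S=\bigcup_{k=0}^{L}S_k$ be a finite layered state space with nonempty disjoint layers, $S_0=\{s_0\}$, $S_L=\{s_L\}$, let $A$ be a finite action set and $P$ a known transition function which from any state of $S_k$ ($k<L$) leads, under any action, to $S_{k+1}$. A policy is a map $\pi(\cdot\mid s)$ from states to probability distributions on $A$; $q^\pi(s,a)$ is the probability that an episode started at $s_0$ and played with $\pi$ visits $s$ and takes $a$ there, $\mathcal Q=\{q^\pi\}$, $q(s)=\sum_a q(s,a)$, and $\langle \ell,q\rangle=\sum_{s,a}\ell(s,a)q(s,a)$. A trajectory is possible if all its transitions have positive probability; its path loss is $\sum_{k<L}\ell(s_k,a_k)$. In each episode $t=1,\dots,T$ a (possibly randomized) algorithm chooses a policy $\pi_t$ from its internal randomness and the outcomes of the previous episodes (it may also know $T$), then observes the trajectory $((s_k,a_k))_{k<L}$ drawn from $\pi_t$ and $P$, and one aggregate feedback bit $c_t$, which given the trajectory is Bernoulli with parameter $\sum_{k<L}\ell(s_k,a_k)$. An *instance* is a function $\ell:S\times A\to[-1,1]$ with $\ell(s_L,\cdot)=0$ such that the path loss of every possible trajectory lies in $[0,1]$ (individual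 values may be negative). Put $$\mathrm{Reg}_T=\max_{\pi}\mathbf E\Big[\sum_{t=1}^T\langle \ell,q^{\pi_t}-q^{\pi}\rangle\Big].$$ For $\epsilon\in(0,1)$ the algorithm is *$\epsilon$-consistent* if for every instance $\ell$ there is $M>0$, independent of $T$, with $\mathrm{Reg}_T\le M\,T^{1-\epsilon}$ for all $T$. **Theorem.** There is a universal constant $c>0$ such that the following holds for every such MDP, every $\epsilon\in(0,1)$ and every $\epsilon$-consistent algorithm. Let $\ell^*:S\times A\to[0,1]$ satisfy $\ell^*(s_L,\cdot)=0$ and suppose that the path loss of every possible trajectory under $\ell^*$ lies in $[3/8,5/8]$. Let $Q^*,V^*$ be the optimal value functions: $V^*(s)=\min_a Q^*(s,a)$, $Q^*(s_L,a)=0$, $Q^*(s,a)=\ell^*(s,a)+\sum_{s'}P(s'\mid s,a)V^*(s')$ for $s\ne s_L$; let $\Delta(s,a)=Q^*(s,a)-V^*(s)$, and let $S^*$ be the set of states $s\neq s_L$ with $q(s)>0$ for some $q\in\arg\min_{q\in\mathcal Q}\langle\ell^*,q\rangle$. Then, on the instance $\ell^*$, $$\liminf_{T\to\infty}\frac{\mathrm{Reg}_T}{\log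 T}\;\ge\; c\,\epsilon\sum_{s\in S^*}\ \sum_{a\in A:\ \Delta(s,a)>0}\frac1{\Delta(s,a)} .$$ -/

import Mathlib

open MeasureTheory Filter

namespace AggregateMDP

noncomputable section

/-- A finite-horizon episodic MDP with finite state space `S`, finite action set `A` and layers
`0, …, L`: layer `0` is `{init}`, layer `L` is `{terminal}`, every layer is nonempty, and from a
state of layer `k < L` every action leads to layer `k + 1`.
`P s a s'` is the probability of moving from `s` to `s'` under the action `a`. -/
structure LayeredMDP (S A : Type*) [Fintype S] (L : ℕ) where
  layer : S → Fin (L + 1)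
  init : S
  terminal : S
  layer_eq_zero_iff : ∀ s, layer s = 0 ↔ s = init
  layer_eq_last_iff : ∀ s, layer s = Fin.last L ↔ s = terminal
  layer_surjective : Function.Surjective layer
  P : S → A → S → ℝ
  P_mem : ∀ s a s', P s a s' ∈ Set.Icc (0 : ℝ) 1
  P_sum : ∀ s a, s ≠ terminal → ∑ s', P s a s' = 1
  P_layer : ∀ s a s', s ≠ terminal → (layer s' : ℕ) ≠ (layer s : ℕ) + 1 → P s a s' = 0

/-- A (stochastic, Markov) policy: `(π s).1 a` is the probability of choosing `a` in state `s`. -/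
abbrev Policy (S A : Type*) [Fintype A] := S → stdSimplex ℝ A

/-- A state-action trajectory of one episode: the states `s_0, …, s_L` and the actions
`a_0, …, a_{L-1}`. -/
abbrev Trajectory (S A : Type*) (L : ℕ) := (Fin (L + 1) → S) × (Fin L → A)

/-- What the player sees in one episode: the trajectory and the aggregate feedback
`c ∈ {0, 1}` (`true` stands for `1`). -/
abbrev Outcome (S A : Type*) (L : ℕ) := Trajectory S A L × Bool

/-- The aggregate (mean) loss `∑_{k < L} ℓ(s_k, a_k)` of a trajectory. -/
def pathLoss {S A : Type*} {L : ℕ} (l : S → A → ℝ) (τ : Trajectory S A L) : ℝ :=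
  ∑ k : Fin L, l (τ.1 k.castSucc) (τ.2 k)

/-- A randomized algorithm. `Ω` is the space of its internal random seed, distributed according
to the probability measure `seed`; the policy for episode `t` (counting from `0`) is a function
of the seed and of the outcomes of the `t` previous episodes. The transition function is known:
the algorithm may be designed for one given MDP. -/
structure Algorithm (Ω S A : Type*) [MeasurableSpace Ω] [Fintype A] (L : ℕ) where
  seed : Measure Ω
  seed_prob : IsProbabilityMeasure seed
  policy : (t : ℕ) → Ω → (Fin t → Outcome S A L) → Policy S A
  measurable_policy : ∀ t h, Measurable fun ω => policy t ω h

/-- The outcomes of the episodes before `t` in a sequence of `T` outcomes. -/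
def past {X : Type*} {T : ℕ} (h : Fin T → X) (t : Fin T) : Fin t → X :=
  fun i => h (Fin.castLE t.isLt.le i)

namespace LayeredMDP

variable {S A : Type*} [Fintype S] [Fintype A] {L : ℕ} (M : LayeredMDP S A L)

/-- The trajectory has positive probability under some policy. -/
def IsPossible (τ : Trajectory S A L) : Prop :=
  τ.1 0 = M.init ∧ ∀ k : Fin L, 0 < M.P (τ.1 k.castSucc) (τ.2 k) (τ.1 k.succ)

open Classical in
/-- The probability of a trajectory when the policy `π` is played from `init`. -/
def trajProb (π : Policy S A) (τ : Trajectory S A L) : ℝ :=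
  if τ.1 0 = M.init then
    ∏ k : Fin L, (π (τ.1 k.castSucc)).1 (τ.2 k) * M.P (τ.1 k.castSucc) (τ.2 k) (τ.1 k.succ)
  else 0

open Classical in
/-- The occupancy measure `q^π(s, a)`: the probability that the episode visits the state `s` and
takes the action `a` there. -/
def occ (π : Policy S A) (s : S) (a : A) : ℝ :=
  ∑ τ : Trajectory S A L with ∃ k : Fin L, τ.1 k.castSucc = s ∧ τ.2 k = a, M.trajProb π τ

/-- The set of occupancy measures. -/
def occSet : Set (S → A → ℝ) := Set.range M.occ

/-- The pairing `⟨ℓ, q⟩`. For `q = q^π` it is the expected loss of an episode under `π`. -/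
def pairing (_M : LayeredMDP S A L) (l q : S → A → ℝ) : ℝ := ∑ s, ∑ a, l s a * q s a

/-- `optValueAux l n s` is the least expected loss of the next `n` steps from `s`. -/
def optValueAux (l : S → A → ℝ) : ℕ → S → ℝ
  | 0, _ => 0
  | n + 1, s => ⨅ a, (l s a + ∑ s', M.P s a s' * optValueAux l n s')

/-- The optimal value function `V^*`: backward recursion from the terminal state. -/
def optValue (l : S → A → ℝ) (s : S) : ℝ := M.optValueAux l (L - M.layer s) s

open Classical in
/-- The optimal action-value function `Q^*`. -/
def optQ (l : S → A → ℝ) (s : S) (a : A) : ℝ :=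
  if s = M.terminal then 0 else l s a + ∑ s', M.P s a s' * M.optValue l s'

/-- `V^*(s) = min_a Q^*(s, a)`, so that `optQ` and `optValue` satisfy the Bellman equations. -/
theorem optValue_eq_iInf_optQ (l : S → A → ℝ) (s : S) :
    M.optValue l s = ⨅ a, M.optQ l s a := by
  by_cases hs : s = M.terminal
  · have h1 : M.layer s = Fin.last L := (M.layer_eq_last_iff s).2 hs
    simp [optValue, optQ, hs ▸ h1, hs, optValueAux]
  · have h1 : M.layer s ≠ Fin.last L := fun h => hs ((M.layer_eq_last_iff s).1 h)
    have h2 : (M.layer s : ℕ) < L := Fin.val_lt_last h1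
    obtain ⟨n, hn⟩ : ∃ n, L - (M.layer s : ℕ) = n + 1 := ⟨L - M.layer s - 1, by omega⟩
    simp only [optValue, hn, optValueAux, optQ, if_neg hs]
    congr 1
    ext a
    congr 1
    refine Finset.sum_congr rfl fun s' _ => ?_
    by_cases h3 : (M.layer s' : ℕ) = (M.layer s : ℕ) + 1
    · have h4 : L - (M.layer s' : ℕ) = n := by omega
      rw [h4]
    · simp [M.P_layer s a s' hs h3]

/-- The suboptimality gap `Δ(s, a) = Q^*(s, a) - V^*(s)`. -/
def gap (l : S → A → ℝ) (s : S) (a : A) : ℝ := M.optQ l s a - M.optValue l s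

/-- The set `𝒬^*` of optimal occupancy measures. -/
def optOccSet (l : S → A → ℝ) : Set (S → A → ℝ) :=
  {q | q ∈ M.occSet ∧ ∀ q' ∈ M.occSet, M.pairing l q ≤ M.pairing l q'}

/-- The set `S^*` of non-terminal states that some optimal policy reaches with positive
probability. -/
def optStates (l : S → A → ℝ) : Set S :=
  {s | s ≠ M.terminal ∧ ∃ q ∈ M.optOccSet l, 0 < ∑ a, q s a}

/-- A stochastic instance on the MDP: a mean loss function `ℓ`, vanishing at the terminal state,
for which the aggregate loss of every possible trajectory lies in `[0, 1]`, so that it is the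
parameter of a Bernoulli distribution. The individual values may be negative. -/
def IsInstance (l : S → A → ℝ) : Prop :=
  (∀ s a, l s a ∈ Set.Icc (-1 : ℝ) 1) ∧ (∀ a, l M.terminal a = 0) ∧
    ∀ τ : Trajectory S A L, M.IsPossible τ → pathLoss l τ ∈ Set.Icc (0 : ℝ) 1

/-- The probability of an outcome `(τ, c)` of one episode when `π` is played: `τ` is drawn from
`π` and the transitions, then `c` from the Bernoulli distribution of parameter `pathLoss l τ`. -/
def outcomeProb (l : S → A → ℝ) (π : Policy S A) (x : Outcome S A L) : ℝ :=
  M.trajProb π x.1 * (if x.2 then pathLoss l x.1 else 1 - pathLoss l x.1)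

variable {Ω : Type*} [MeasurableSpace Ω]

/-- The probability that the first `T` episodes have the outcomes `h`, given the seed `ω`. -/
def histProb (l : S → A → ℝ) (alg : Algorithm Ω S A L) (ω : Ω) {T : ℕ}
    (h : Fin T → Outcome S A L) : ℝ :=
  ∏ t : Fin T, M.outcomeProb l (alg.policy t ω (past h t)) (h t)

/-- `Reg_T(π') = E[∑_t ⟨ℓ, q^{π_t} - q^{π'}⟩]`, the expectation being over the seed and over the
outcomes of the `T` episodes. -/
def regretAgainst (l : S → A → ℝ) (alg : Algorithm Ω S A L) (π' : Policy S A) (T : ℕ) : ℝ :=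
  ∫ ω, ∑ h : Fin T → Outcome S A L, M.histProb l alg ω h *
    ∑ t : Fin T, (M.pairing l (M.occ (alg.policy t ω (past h t))) - M.pairing l (M.occ π'))
    ∂alg.seed

/-- `Reg_T = max_{π'} Reg_T(π')`. -/
def regret (l : S → A → ℝ) (alg : Algorithm Ω S A L) (T : ℕ) : ℝ :=
  ⨆ π' : Policy S A, M.regretAgainst l alg π' T

/-- Consistency with exponent `ε`: on every stochastic instance, `Reg_T ≤ C T^{1-ε}` with a
constant that does not depend on `T`. `alg T` is the algorithm run when the horizon is `T`
(an algorithm that does not use the horizon is a constant family). -/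
def IsConsistent (alg : ℕ → Algorithm Ω S A L) (ε : ℝ) : Prop :=
  ∀ l : S → A → ℝ, M.IsInstance l →
    ∃ C : ℝ, 0 < C ∧ ∀ T : ℕ, M.regret l (alg T) T ≤ C * (T : ℝ) ^ (1 - ε)

end LayeredMDP

end

end AggregateMDP

set_option linter.unusedSectionVars false

namespace AggregateMDP

noncomputable section

/-! The proof is a change of measure for each suboptimal pair separately. Fix `s` in $S^*$ and an
action `a` with gap $\Delta>0$, and lower the loss at `(s, a)` alone by $\frac54\Delta$. By the
performance difference identity (`pairing_occ_eq_optValue_add`), the excess of a policy over $V^*$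
on the original instance is $\sum \Delta(s',a')q(s',a')\ge\Delta q(s,a)$, so on the lowered instance
its value is at least $V^*-\frac\Delta4 q(s,a)$. As `s` lies in $S^*$, some policy playing `(s, a)`
with probability $p>0$ uses no other pair of positive gap (`exists_policy_deviating`), and attains
$V^*-\frac\Delta4 p$. Hence a policy that seldom plays `(s, a)` has regret of order $\Delta p$ on
the lowered instance (`exists_le_occ_add_gap_lowerAt`).

The two instances differ only in the feedback bit of episodes through `(s, a)`, so an episode
contributes divergence at most $27\Delta^2q^\pi(s,a)$ (`sum_outcomeProb_mul_log_le`). With $N$ the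
expected number of plays of `(s, a)` on the original instance, the Bretagnolle-Huber inequality
bounds $T p\,e^{-27\Delta^2N}/2$ by $N$ plus $4/\Delta$ times the regret on the lowered instance.
Consistency on both instances makes this $O(T^{1-\epsilon})$, whence $27\Delta^2N\ge\epsilon\log
T-O(1)$.

The regret dominates $\sum\Delta N$, which adds the bounds over pairs and gives $c=1/27$. The
unknown $p$ enters only the $O(1)$ term, so $c$ is independent of reachability. The lowered loss is
a legal instance because gaps on $S^*$ are at most the range $1/4$ of the path losses
(`gap_le_of_mem_optStates`). -/

/-- The probability of a sequence of observations whose law at time `t`, given the past `g`,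
is `κ t g`. -/
def seqProb {X : Type*} (κ : (t : ℕ) → (Fin t → X) → X → ℝ) {T : ℕ} (h : Fin T → X) : ℝ :=
  ∏ t : Fin T, κ t (past h t) (h t)

/-! ### Adaptive observation sequences and the Bretagnolle-Huber inequality. -/

section Sequences

variable {X : Type*} (κ κ' : (t : ℕ) → (Fin t → X) → X → ℝ)

theorem past_snoc_castSucc {T : ℕ} (h : Fin T → X) (x : X) (t : Fin T) :
    past (Fin.snoc h x : Fin (T + 1) → X) t.castSucc = past h t := by
  funext i
  simp only [past]
  have : Fin.castLE t.castSucc.isLt.le i = (Fin.castLE t.isLt.le i : Fin T).castSucc := rfl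
  rw [this, Fin.snoc_castSucc (α := fun _ => X)]

theorem past_snoc_last {T : ℕ} (h : Fin T → X) (x : X) :
    past (Fin.snoc h x : Fin (T + 1) → X) (Fin.last T) = h := by
  funext i
  simp only [past]
  have : Fin.castLE (Fin.last T).isLt.le i = i.castSucc := rfl
  rw [this, Fin.snoc_castSucc (α := fun _ => X)]

theorem seqProb_snoc {T : ℕ} (h : Fin T → X) (x : X) :
    seqProb κ (Fin.snoc h x : Fin (T + 1) → X) = seqProb κ h * κ T h x := by
  simp only [seqProb, Fin.prod_univ_castSucc, past_snoc_castSucc, past_snoc_last,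
    Fin.snoc_last, Fin.snoc_castSucc (α := fun _ => X)]
  rfl

theorem sum_snoc [Fintype X] {T : ℕ} (F : (Fin (T + 1) → X) → ℝ) :
    ∑ h, F h = ∑ h : Fin T → X, ∑ x : X, F (Fin.snoc h x : Fin (T + 1) → X) := by
  rw [← (Fin.snocEquiv (fun _ : Fin (T + 1) => X)).sum_comp, Fintype.sum_prod_type,
    Finset.sum_comm]
  rfl

theorem seqProb_nonneg (h0 : ∀ t g x, 0 ≤ κ t g x) {T : ℕ} (h : Fin T → X) : 0 ≤ seqProb κ h :=
  Finset.prod_nonneg fun _ _ => h0 _ _ _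

theorem seqProb_pos_left {T : ℕ} {h : Fin T → X} (h0 : ∀ t g x, 0 ≤ κ t g x)
    (hp : seqProb κ h ≠ 0) (t : Fin T) : 0 < κ t (past h t) (h t) :=
  lt_of_le_of_ne (h0 _ _ _) (Ne.symm (Finset.prod_ne_zero_iff.1 hp t (Finset.mem_univ t)))

variable [Fintype X]

theorem sum_seqProb (h1 : ∀ t g, ∑ x, κ t g x = 1) (T : ℕ) :
    ∑ h : Fin T → X, seqProb κ h = 1 := by
  induction T with
  | zero => simp [seqProb]
  | succ T ih =>
    rw [sum_snoc]
    simp only [seqProb_snoc, ← Finset.mul_sum, h1, mul_one, ih]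

/-- In the expectation of a sum of functions of the past and the present, the present may be
integrated out. -/
theorem sum_seqProb_mul_sum (h1 : ∀ t g, ∑ x, κ t g x = 1)
    (f : (t : ℕ) → (Fin t → X) → X → ℝ) (T : ℕ) :
    ∑ h : Fin T → X, seqProb κ h * ∑ t : Fin T, f t (past h t) (h t) =
      ∑ h : Fin T → X, seqProb κ h * ∑ t : Fin T, ∑ x, κ t (past h t) x * f t (past h t) x := by
  induction T with
  | zero => simp
  | succ T ih =>
    rw [sum_snoc, sum_snoc]
    simp only [seqProb_snoc, Fin.sum_univ_castSucc, past_snoc_castSucc, past_snoc_last,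
      Fin.snoc_last, Fin.snoc_castSucc (α := fun _ => X), Fin.val_castSucc, Fin.val_last]
    have key : ∀ (h : Fin T → X) (a b : ℝ) (w : X → ℝ),
        ∑ x, seqProb κ h * κ T h x * (a + w x)
          = seqProb κ h * a + seqProb κ h * ∑ x, κ T h x * w x := by
      intro h a b w
      have : ∀ x, seqProb κ h * κ T h x * (a + w x)
          = seqProb κ h * a * κ T h x + seqProb κ h * (κ T h x * w x) := fun x => by ring
      rw [Finset.sum_congr rfl fun x _ => this x, Finset.sum_add_distrib, ← Finset.mul_sum,
        ← Finset.mul_sum, h1, mul_one]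
    have e1 : ∀ h : Fin T → X, _ := fun h =>
      key h (∑ t : Fin T, f t (past h t) (h t)) 0 (fun x => f T h x)
    have e2 : ∀ h : Fin T → X, _ := fun h =>
      key h (∑ t : Fin T, ∑ x, κ t (past h t) x * f t (past h t) x) 0
        (fun _ => ∑ x, κ T h x * f T h x)
    rw [Finset.sum_congr rfl fun h _ => e1 h, Finset.sum_congr rfl fun h _ => e2 h]
    simp only [Finset.sum_add_distrib, ih, ← Finset.sum_mul, h1, one_mul]

/-- The Bretagnolle-Huber inequality on a finite type. -/
theorem exp_neg_sum_le_two_mul_sum_min {ι : Type*} [Fintype ι] (p q : ι → ℝ)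
    (p0 : ∀ i, 0 ≤ p i) (q0 : ∀ i, 0 ≤ q i) (p1 : ∑ i, p i = 1) (q1 : ∑ i, q i = 1)
    (hpq : ∀ i, p i ≠ 0 → q i ≠ 0) :
    Real.exp (-∑ i, p i * Real.log (p i / q i)) ≤ 2 * ∑ i, min (p i) (q i) := by
  set K := ∑ i, p i * Real.log (p i / q i)
  -- Jensen for the exponential, through its tangent at the mean: $\sqrt{pq}=p\,e^{-\log(p/q)/2}$,
  -- and the linear terms cancel after summation.
  have h1 : Real.exp (-K / 2) ≤ ∑ i, Real.sqrt (p i * q i) := by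
    have h2 : ∀ i, p i * (Real.exp (-K / 2) * (1 + (-Real.log (p i / q i) / 2 + K / 2)))
        ≤ Real.sqrt (p i * q i) := by
      intro i
      by_cases hp : p i = 0
      · simp [hp]
      have hp' : 0 < p i := lt_of_le_of_ne (p0 i) (Ne.symm hp)
      have hq' : 0 < q i := lt_of_le_of_ne (q0 i) (Ne.symm (hpq i hp))
      have h3 : Real.sqrt (p i * q i) = p i * Real.exp (-Real.log (p i / q i) / 2) := by
        rw [Real.sqrt_eq_iff_mul_self_eq (by positivity) (by positivity)]
        have : p i * Real.exp (-Real.log (p i / q i) / 2)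
            * (p i * Real.exp (-Real.log (p i / q i) / 2))
            = p i * p i * Real.exp (-Real.log (p i / q i)) := by
          rw [mul_mul_mul_comm, ← Real.exp_add]; ring_nf
        rw [this, Real.exp_neg, Real.exp_log (by positivity)]
        field_simp
      rw [h3]
      gcongr
      calc _ ≤ Real.exp (-K / 2) * Real.exp (-Real.log (p i / q i) / 2 + K / 2) := by
            gcongr
            linarith [Real.add_one_le_exp (-Real.log (p i / q i) / 2 + K / 2)]
        _ = _ := by rw [← Real.exp_add]; ring_nf
    refine le_trans (le_of_eq ?_) (Finset.sum_le_sum fun i _ => h2 i)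
    have h4 : ∀ i, p i * (Real.exp (-K / 2) * (1 + (-Real.log (p i / q i) / 2 + K / 2)))
        = Real.exp (-K / 2) * (1 + K / 2) * p i
          - Real.exp (-K / 2) / 2 * (p i * Real.log (p i / q i)) := fun i => by ring
    rw [Finset.sum_congr rfl fun i _ => h4 i, Finset.sum_sub_distrib, ← Finset.mul_sum,
      ← Finset.mul_sum, p1]
    change _ = _ - _ * K
    ring
  -- Cauchy-Schwarz, using $pq=\min(p,q)\max(p,q)$.
  have h5 : (∑ i, Real.sqrt (p i * q i)) ^ 2 ≤ (∑ i, min (p i) (q i)) * ∑ i, max (p i) (q i) := by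
    have := Finset.sum_sq_le_sum_mul_sum_of_sq_le_mul Finset.univ
      (r := fun i => Real.sqrt (p i * q i)) (f := fun i => min (p i) (q i))
      (g := fun i => max (p i) (q i)) (fun i _ => le_min (p0 i) (q0 i))
      (fun i _ => le_max_of_le_left (p0 i))
      (fun i _ => by rw [Real.sq_sqrt (mul_nonneg (p0 i) (q0 i)), min_mul_max])
    exact this
  have h6 : ∑ i, max (p i) (q i) ≤ 2 := by
    calc ∑ i, max (p i) (q i) ≤ ∑ i, (p i + q i) :=
          Finset.sum_le_sum fun i _ => max_le_add_of_nonneg (p0 i) (q0 i)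
      _ = 2 := by rw [Finset.sum_add_distrib, p1, q1]; norm_num
  have h7 : 0 ≤ ∑ i, min (p i) (q i) := Finset.sum_nonneg fun i _ => le_min (p0 i) (q0 i)
  have h8 : Real.exp (-K) = Real.exp (-K / 2) ^ 2 := by rw [← Real.exp_nat_mul]; ring_nf
  rw [h8]
  have h9 : Real.exp (-K / 2) ^ 2 ≤ (∑ i, Real.sqrt (p i * q i)) ^ 2 := by gcongr
  nlinarith

/-- Chain rule: the log-likelihood ratio of a sequence is a sum over time, so its mean is the
expected sum of the conditional divergences, each at most `D`. The law of the past is that of `κ`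
throughout. -/
theorem exp_neg_le_two_mul_sum_min_seqProb (h0 : ∀ t g x, 0 ≤ κ t g x)
    (h0' : ∀ t g x, 0 ≤ κ' t g x) (h1 : ∀ t g, ∑ x, κ t g x = 1)
    (h1' : ∀ t g, ∑ x, κ' t g x = 1) (hac : ∀ t g x, 0 < κ t g x → 0 < κ' t g x)
    (D : (t : ℕ) → (Fin t → X) → ℝ)
    (hD : ∀ t g, ∑ x, κ t g x * Real.log (κ t g x / κ' t g x) ≤ D t g) (T : ℕ) :
    Real.exp (-∑ h : Fin T → X, seqProb κ h * ∑ t : Fin T, D t (past h t)) ≤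
      2 * ∑ h : Fin T → X, min (seqProb κ h) (seqProb κ' h) := by
  have hpos := fun (h : Fin T → X) (hp : seqProb κ h ≠ 0) => seqProb_pos_left κ h0 hp
  refine le_trans ?_ (exp_neg_sum_le_two_mul_sum_min _ _ (seqProb_nonneg κ h0)
    (seqProb_nonneg κ' h0') (sum_seqProb κ h1 T) (sum_seqProb κ' h1' T) ?_)
  · rw [Real.exp_le_exp, neg_le_neg_iff]
    have e : ∀ h : Fin T → X, seqProb κ h * Real.log (seqProb κ h / seqProb κ' h)
        = seqProb κ h * ∑ t : Fin T,
          Real.log (κ t (past h t) (h t) / κ' t (past h t) (h t)) := by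
      intro h
      by_cases hp : seqProb κ h = 0
      · simp [hp]
      congr 1
      rw [seqProb, seqProb, ← Finset.prod_div_distrib, Real.log_prod]
      intro t _
      have := hpos h hp t
      exact (div_pos this (hac _ _ _ this)).ne'
    rw [Finset.sum_congr rfl fun h _ => e h,
      sum_seqProb_mul_sum κ h1 (fun t g x => Real.log (κ t g x / κ' t g x))]
    exact Finset.sum_le_sum fun h _ => mul_le_mul_of_nonneg_left
      (Finset.sum_le_sum fun t _ => hD _ _) (seqProb_nonneg κ h0 h)
  · intro h hp
    exact Finset.prod_ne_zero_iff.2 fun t _ => (hac _ _ _ (hpos h hp t)).ne'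

end Sequences

/-- From $\log x\le x-1$ the divergence is at most $(p-q)^2/(q(1-q))$. The bound $d\le1/4$ keeps `q`
in $[1/16,5/8]$, away from 0 and 1. -/
theorem bernoulli_kl_le {p q d : ℝ} (hp : p ∈ Set.Icc (3 / 8 : ℝ) (5 / 8)) (hd : 0 ≤ d)
    (hd' : d ≤ 1 / 4) (hq : q = p - 5 / 4 * d) :
    p * Real.log (p / q) + (1 - p) * Real.log ((1 - p) / (1 - q)) ≤ 27 * d ^ 2 := by
  obtain ⟨hp1, hp2⟩ := hp
  have hq1 : 1 / 16 ≤ q := by linarith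
  have hq2 : q ≤ 5 / 8 := by linarith
  have hq0 : 0 < q := by linarith
  have hq0' : 0 < 1 - q := by linarith
  have a1 : Real.log (p / q) ≤ p / q - 1 :=
    Real.log_le_sub_one_of_pos (div_pos (by linarith) hq0)
  have a2 : Real.log ((1 - p) / (1 - q)) ≤ (1 - p) / (1 - q) - 1 :=
    Real.log_le_sub_one_of_pos (div_pos (by linarith) hq0')
  have a3 : p * (p / q - 1) + (1 - p) * ((1 - p) / (1 - q) - 1) = (p - q) ^ 2 / (q * (1 - q)) := by
    field_simp
    ring
  have a4 : (p - q) ^ 2 / (q * (1 - q)) ≤ 27 * d ^ 2 := by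
    rw [div_le_iff₀ (by positivity)]
    have : p - q = 5 / 4 * d := by linarith
    rw [this]
    -- The minimum is at $q=1/16$; then $\frac{25}{16}\cdot\frac{256}{15}=\frac{80}{3}\le27$.
    have : 15 / 256 ≤ q * (1 - q) := by nlinarith
    nlinarith [sq_nonneg d]
  have b1 := mul_le_mul_of_nonneg_left a1 (show 0 ≤ p by linarith)
  have b2 := mul_le_mul_of_nonneg_left a2 (show 0 ≤ 1 - p by linarith)
  linarith

/-! ### Expectations over trajectories and their backward recursion. -/

namespace LayeredMDP

variable {S A : Type*} [Fintype S] [Fintype A] {L : ℕ} (M : LayeredMDP S A L)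

/-- The trajectory that starts at `s` with the action `a` and goes on as `τ`. -/
def consTraj {n : ℕ} (s : S) (a : A) (τ : Trajectory S A n) : Trajectory S A (n + 1) :=
  (Fin.cons (α := fun _ => S) s τ.1, Fin.cons (α := fun _ => A) a τ.2)

theorem pathLoss_consTraj {n : ℕ} (l : S → A → ℝ) (s : S) (a : A) (τ : Trajectory S A n) :
    pathLoss l (consTraj s a τ) = l s a + pathLoss l τ := by
  simp only [pathLoss, consTraj, Fin.sum_univ_succ, Fin.castSucc_zero, Fin.cons_zero,
    ← Fin.succ_castSucc, Fin.cons_succ]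

/-- The product of the probabilities of the steps of a trajectory under a policy. -/
def trajWeight (π : Policy S A) {n : ℕ} (τ : Trajectory S A n) : ℝ :=
  ∏ k : Fin n, (π (τ.1 k.castSucc)).1 (τ.2 k) * M.P (τ.1 k.castSucc) (τ.2 k) (τ.1 k.succ)

theorem trajWeight_consTraj (π : Policy S A) {n : ℕ} (s : S) (a : A) (τ : Trajectory S A n) :
    M.trajWeight π (consTraj s a τ) = (π s).1 a * M.P s a (τ.1 0) * M.trajWeight π τ := by
  simp only [trajWeight, consTraj, Fin.prod_univ_succ, Fin.castSucc_zero, Fin.cons_zero,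
    ← Fin.succ_castSucc, Fin.cons_succ]

open Classical in
/-- The expectation of a function of the next `n` steps, when `π` is played from `s`. -/
def pathExp (π : Policy S A) {n : ℕ} (s : S) (Φ : Trajectory S A n → ℝ) : ℝ :=
  ∑ τ : Trajectory S A n, if τ.1 0 = s then M.trajWeight π τ * Φ τ else 0

-- Conditioning on the first step: a trajectory from `s` is a first action together with a tail, and
-- the tails are grouped by their initial state.
open Classical in
theorem pathExp_succ (π : Policy S A) {n : ℕ} (s : S) (Φ : Trajectory S A (n + 1) → ℝ) :
    M.pathExp π s Φ = ∑ a, (π s).1 a * ∑ s', M.P s a s' *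
      M.pathExp π s' (fun τ : Trajectory S A n => Φ (consTraj s a τ)) := by
  have h1 : M.pathExp π s Φ = ∑ x : A × Trajectory S A n,
      M.trajWeight π (consTraj s x.1 x.2) * Φ (consTraj s x.1 x.2) := by
    unfold pathExp
    rw [← Finset.sum_filter]
    symm
    refine Finset.sum_bij' (fun x _ => consTraj s x.1 x.2)
      (fun τ _ => (τ.2 0, (fun i => τ.1 i.succ, fun i => τ.2 i.succ))) ?_ ?_ ?_ ?_ ?_
    · intro x _
      simp [consTraj]
    · intro τ _
      exact Finset.mem_univ _
    · intro x _
      simp [consTraj]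
    · intro τ hτ
      obtain ⟨τ1, τ2⟩ := τ
      simp only [Finset.mem_filter, Finset.mem_univ, true_and] at hτ
      subst hτ
      exact Prod.ext (Fin.cons_self_tail τ1) (Fin.cons_self_tail τ2)
    · intro x _
      rfl
  rw [h1, Fintype.sum_prod_type]
  refine Finset.sum_congr rfl fun a _ => ?_
  simp only [pathExp, Finset.mul_sum]
  rw [Finset.sum_comm]
  refine Finset.sum_congr rfl fun τ _ => ?_
  rw [Finset.sum_eq_single (τ.1 0)]
  · rw [if_pos rfl, trajWeight_consTraj]
    ring
  · intro s' _ h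
    rw [if_neg (Ne.symm h), mul_zero, mul_zero]
  · intro h
    exact absurd (Finset.mem_univ _) h

theorem pathExp_add (π : Policy S A) {n : ℕ} (s : S) (Φ Ψ : Trajectory S A n → ℝ) :
    M.pathExp π s (fun τ => Φ τ + Ψ τ) = M.pathExp π s Φ + M.pathExp π s Ψ := by
  simp only [pathExp, ← Finset.sum_add_distrib]
  refine Finset.sum_congr rfl fun τ _ => ?_
  split_ifs <;> ring

theorem pathExp_const (π : Policy S A) {n : ℕ} (s : S) (c : ℝ) :
    M.pathExp π s (fun _ : Trajectory S A n => c) =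
      c * M.pathExp π s (fun _ : Trajectory S A n => 1) := by
  simp only [pathExp, Finset.mul_sum]
  refine Finset.sum_congr rfl fun τ _ => ?_
  split_ifs <;> ring

theorem ne_terminal_of_layer_lt {s : S} (h : (M.layer s : ℕ) < L) : s ≠ M.terminal := by
  intro hs
  rw [(M.layer_eq_last_iff s).2 hs] at h
  simp at h

theorem layer_init : (M.layer M.init : ℕ) = 0 := by
  rw [(M.layer_eq_zero_iff M.init).2 rfl]; rfl

theorem layer_eq_of_P_ne_zero {s s' : S} {a : A} (hs : s ≠ M.terminal) (h : M.P s a s' ≠ 0) :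
    (M.layer s' : ℕ) = M.layer s + 1 := by
  by_contra h1
  exact h (M.P_layer s a s' hs h1)

/-- In an average over the next state, two functions that agree on the next layer are
interchangeable. -/
theorem sum_P_congr {s : S} {a : A} (hs : s ≠ M.terminal) {f g : S → ℝ}
    (h : ∀ s', (M.layer s' : ℕ) = M.layer s + 1 → f s' = g s') :
    ∑ s', M.P s a s' * f s' = ∑ s', M.P s a s' * g s' := by
  refine Finset.sum_congr rfl fun s' _ => ?_
  by_cases h1 : M.P s a s' = 0
  · simp [h1]
  · rw [h s' (M.layer_eq_of_P_ne_zero hs h1)]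

theorem pathExp_one (π : Policy S A) : ∀ (n : ℕ) (s : S), (M.layer s : ℕ) + n = L →
    M.pathExp π s (fun _ : Trajectory S A n => 1) = 1 := by
  classical
  intro n
  induction n with
  | zero =>
    intro s _
    simp only [pathExp, trajWeight, Fintype.sum_prod_type]
    rw [Finset.sum_eq_single (fun _ => s)]
    · simp
    · intro b _ hb
      have : b 0 ≠ s := fun h => hb (funext fun i => by rw [Fin.fin_one_eq_zero i]; exact h)
      simp [this]
    · intro h
      exact absurd (Finset.mem_univ _) h
  | succ n ih =>
    intro s hs
    have hs' : s ≠ M.terminal := M.ne_terminal_of_layer_lt (by omega)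
    rw [pathExp_succ]
    have : ∀ a, ∑ s', M.P s a s' * M.pathExp π s' (fun _ : Trajectory S A n => 1) = 1 := by
      intro a
      rw [M.sum_P_congr hs' (g := fun _ => 1) fun s' h => ih s' (by omega)]
      simpa using M.P_sum s a hs'
    simp only [this, mul_one]
    exact (π s).2.2

/-- The expected sum of `f` over the next `n` steps, when `π` is played from `s`. -/
def polValue (π : Policy S A) (f : S → A → ℝ) : ℕ → S → ℝ
  | 0, _ => 0
  | n + 1, s => ∑ a, (π s).1 a * (f s a + ∑ s', M.P s a s' * polValue π f n s')

theorem pathExp_pathLoss (π : Policy S A) (f : S → A → ℝ) : ∀ (n : ℕ) (s : S),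
    (M.layer s : ℕ) + n = L →
      M.pathExp π s (fun τ : Trajectory S A n => pathLoss f τ) = M.polValue π f n s := by
  intro n
  induction n with
  | zero =>
    intro s _
    simp [pathExp, pathLoss, polValue]
  | succ n ih =>
    intro s hs
    have hs' : s ≠ M.terminal := M.ne_terminal_of_layer_lt (by omega)
    rw [pathExp_succ, polValue]
    refine Finset.sum_congr rfl fun a _ => ?_
    congr 1
    simp only [pathLoss_consTraj, pathExp_add, mul_add, Finset.sum_add_distrib]
    congr 1
    · rw [M.sum_P_congr hs' (g := fun _ => f s a) fun s' h => by
        rw [pathExp_const, M.pathExp_one π n s' (by omega), mul_one]]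
      rw [← Finset.sum_mul, M.P_sum s a hs', one_mul]
    · exact M.sum_P_congr hs' fun s' h => ih s' (by omega)

theorem sum_trajProb_mul (π : Policy S A) (Φ : Trajectory S A L → ℝ) :
    ∑ τ, M.trajProb π τ * Φ τ = M.pathExp π M.init Φ := by
  simp only [pathExp, trajProb, trajWeight, ite_mul, zero_mul]

theorem trajProb_nonneg (π : Policy S A) (τ : Trajectory S A L) : 0 ≤ M.trajProb π τ := by
  unfold trajProb
  split_ifs
  · exact Finset.prod_nonneg fun k _ => mul_nonneg ((π _).2.1 _) (M.P_mem _ _ _).1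
  · exact le_rfl

theorem sum_trajProb (π : Policy S A) : ∑ τ, M.trajProb π τ = 1 := by
  have := M.sum_trajProb_mul π (fun _ => 1)
  rw [M.pathExp_one π L M.init (by rw [layer_init, zero_add])] at this
  simpa using this

theorem isPossible_of_trajProb_ne_zero {π : Policy S A} {τ : Trajectory S A L}
    (h : M.trajProb π τ ≠ 0) :
    M.IsPossible τ ∧ ∀ k : Fin L, 0 < (π (τ.1 k.castSucc)).1 (τ.2 k) := by
  unfold trajProb at h
  split_ifs at h with h0
  · rw [Finset.prod_ne_zero_iff] at h
    have h1 := fun k => mul_ne_zero_iff.1 (h k (Finset.mem_univ k))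
    exact ⟨⟨h0, fun k => lt_of_le_of_ne (M.P_mem _ _ _).1 (h1 k).2.symm⟩,
      fun k => lt_of_le_of_ne ((π _).2.1 _) (h1 k).1.symm⟩
  · exact absurd rfl h

theorem trajProb_pos {π : Policy S A} {τ : Trajectory S A L} (h : M.IsPossible τ)
    (h' : ∀ k : Fin L, 0 < (π (τ.1 k.castSucc)).1 (τ.2 k)) : 0 < M.trajProb π τ := by
  unfold trajProb
  rw [if_pos h.1]
  exact Finset.prod_pos fun k _ => mul_pos (h' k) (h.2 k)

theorem IsPossible.layer_eq {M : LayeredMDP S A L} {τ : Trajectory S A L} (h : M.IsPossible τ)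
    (k : Fin (L + 1)) : (M.layer (τ.1 k) : ℕ) = k := by
  induction k using Fin.induction with
  | zero => rw [h.1, layer_init]; rfl
  | succ k ih =>
    have h1 : τ.1 k.castSucc ≠ M.terminal := M.ne_terminal_of_layer_lt (by rw [ih]; simp)
    rw [M.layer_eq_of_P_ne_zero h1 (h.2 k).ne', ih]
    simp

/-! ### Occupancy measures. -/

open Classical in
theorem IsPossible.sum_visits {M : LayeredMDP S A L} {τ : Trajectory S A L} (h : M.IsPossible τ)
    (f : S → A → ℝ) :
    ∑ s, ∑ a, (if ∃ k : Fin L, τ.1 k.castSucc = s ∧ τ.2 k = a then f s a else 0) =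
      pathLoss f τ := by
  rw [← Fintype.sum_prod_type' (f := fun s a =>
    if ∃ k : Fin L, τ.1 k.castSucc = s ∧ τ.2 k = a then f s a else 0), ← Finset.sum_filter]
  -- The layer of a state reveals the time of its visit, so no pair is visited twice and the sum
  -- over visited pairs is the sum over times.
  have hinj : Function.Injective fun k : Fin L => (τ.1 k.castSucc, τ.2 k) := by
    intro k j hkj
    have h1 := congrArg (fun x : S × A => (M.layer x.1 : ℕ)) hkj
    simp only [h.layer_eq] at h1
    exact Fin.ext h1
  have himg : (Finset.univ.filter fun x : S × A =>
      ∃ k : Fin L, τ.1 k.castSucc = x.1 ∧ τ.2 k = x.2) =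
      Finset.univ.image fun k : Fin L => (τ.1 k.castSucc, τ.2 k) := by
    ext x
    simp [Prod.ext_iff]
  rw [himg, Finset.sum_image (fun _ _ _ _ h => hinj h)]
  rfl

open Classical in
theorem pairing_occ_eq_sum (π : Policy S A) (f : S → A → ℝ) :
    M.pairing f (M.occ π) = ∑ τ, M.trajProb π τ * pathLoss f τ := by
  have h1 : ∀ s a, f s a * M.occ π s a = ∑ τ : Trajectory S A L, M.trajProb π τ *
      (if ∃ k : Fin L, τ.1 k.castSucc = s ∧ τ.2 k = a then f s a else 0) := by
    intro s a
    rw [occ, Finset.sum_filter, Finset.mul_sum]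
    refine Finset.sum_congr rfl fun τ _ => ?_
    split_ifs <;> ring
  simp only [pairing, h1]
  rw [Finset.sum_congr rfl fun s _ => Finset.sum_comm, Finset.sum_comm]
  refine Finset.sum_congr rfl fun τ _ => ?_
  by_cases hτ : M.trajProb π τ = 0
  · simp [hτ]
  · rw [← (M.isPossible_of_trajProb_ne_zero hτ).1.sum_visits f, Finset.mul_sum]
    simp only [Finset.mul_sum]

theorem pairing_occ (π : Policy S A) (f : S → A → ℝ) :
    M.pairing f (M.occ π) = M.polValue π f L M.init := by
  rw [pairing_occ_eq_sum, sum_trajProb_mul,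
    M.pathExp_pathLoss π f L M.init (by rw [layer_init, zero_add])]

theorem occ_nonneg (π : Policy S A) (s : S) (a : A) : 0 ≤ M.occ π s a :=
  Finset.sum_nonneg fun τ _ => M.trajProb_nonneg π τ

theorem occ_le_one (π : Policy S A) (s : S) (a : A) : M.occ π s a ≤ 1 := by
  rw [← M.sum_trajProb π]
  exact Finset.sum_le_univ_sum_of_nonneg fun τ => M.trajProb_nonneg π τ

theorem trajProb_le_occ (π : Policy S A) (τ : Trajectory S A L) (k : Fin L) :
    M.trajProb π τ ≤ M.occ π (τ.1 k.castSucc) (τ.2 k) := by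
  classical
  unfold occ
  exact Finset.single_le_sum (f := fun τ => M.trajProb π τ)
    (fun τ _ => M.trajProb_nonneg π τ) (Finset.mem_filter.2 ⟨Finset.mem_univ τ, k, rfl, rfl⟩)

theorem exists_traj_of_occ_ne_zero {π : Policy S A} {s : S} {a : A} (h : M.occ π s a ≠ 0) :
    ∃ (τ : Trajectory S A L) (k : Fin L), M.trajProb π τ ≠ 0 ∧ τ.1 k.castSucc = s ∧ τ.2 k = a := by
  classical
  obtain ⟨τ, hτ, h1⟩ := Finset.exists_ne_zero_of_sum_ne_zero h
  obtain ⟨k, hk⟩ := (Finset.mem_filter.1 hτ).2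
  exact ⟨τ, k, h1, hk⟩

open Classical in
/-- The indicator of a state-action pair. -/
def single (s : S) (a : A) : S → A → ℝ := fun s' a' => if s' = s ∧ a' = a then 1 else 0

open Classical in
theorem sum_sum_single (s : S) (a : A) (f : S → A → ℝ) :
    ∑ s', ∑ a', single s a s' a' * f s' a' = f s a := by
  rw [Finset.sum_eq_single s, Finset.sum_eq_single a]
  · simp [single]
  · intro b _ hb
    simp [single, hb]
  · simp
  · intro b _ hb
    simp [single, hb]
  · simp

theorem pairing_single (s : S) (a : A) (q : S → A → ℝ) :
    M.pairing (single s a) q = q s a :=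
  sum_sum_single s a q

/-- A visit to `s` contributes the symmetric product $\pi(a\mid s)\pi(b\mid s)$, and the recursion
is linear in the remaining value. -/
theorem polValue_single_mul_comm (π : Policy S A) (s : S) (a b : A) (n : ℕ) (s0 : S) :
    M.polValue π (single s a) n s0 * (π s).1 b = M.polValue π (single s b) n s0 * (π s).1 a := by
  classical
  induction n generalizing s0 with
  | zero => simp [polValue]
  | succ n ih =>
    have h1 : ∀ c d, M.polValue π (single s c) (n + 1) s0 * (π s).1 d =
        (if s0 = s then (π s).1 c * (π s).1 d else 0) +
          ∑ a', (π s0).1 a' * ∑ s', M.P s0 a' s' *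
            (M.polValue π (single s c) n s' * (π s).1 d) := by
      intro c d
      simp only [polValue, mul_add, Finset.sum_add_distrib, add_mul]
      congr 1
      · by_cases h : s0 = s
        · subst h
          simp [single]
        · simp [single, h]
      · simp only [Finset.sum_mul, Finset.mul_sum, mul_assoc]
    rw [h1, h1, mul_comm ((π s).1 b)]
    simp only [ih]

/-- The occupancy measure of a policy is proportional to the policy in every state. -/
theorem occ_mul_comm (π : Policy S A) (s : S) (a b : A) :
    M.occ π s a * (π s).1 b = M.occ π s b * (π s).1 a := by
  rw [← M.pairing_single s a (M.occ π), ← M.pairing_single s b (M.occ π), pairing_occ, pairing_occ,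
    polValue_single_mul_comm]

/-! ### Gaps and the performance difference identity. -/

theorem optQ_eq (l : S → A → ℝ) {s : S} (hs : s ≠ M.terminal) (a : A) :
    M.optQ l s a = l s a + ∑ s', M.P s a s' * M.optValue l s' :=
  if_neg hs

/-- Telescoping: $\ell+PV^*=V^*+\Delta$ at each step, and averaging over actions leaves $V^*$
unchanged. -/
theorem polValue_eq_optValue_add (π : Policy S A) (l : S → A → ℝ) : ∀ (n : ℕ) (s : S),
    (M.layer s : ℕ) + n = L →
      M.polValue π l n s = M.optValue l s + M.polValue π (M.gap l) n s := by
  intro n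
  induction n with
  | zero =>
    intro s hs
    have : L - (M.layer s : ℕ) = 0 := by omega
    simp [polValue, optValue, this, optValueAux]
  | succ n ih =>
    intro s hs
    have hs' : s ≠ M.terminal := M.ne_terminal_of_layer_lt (by omega)
    have h1 : ∀ a, (π s).1 a * (l s a + ∑ s', M.P s a s' * M.polValue π l n s') =
        (π s).1 a * M.optValue l s +
          (π s).1 a * (M.gap l s a + ∑ s', M.P s a s' * M.polValue π (M.gap l) n s') := by
      intro a
      rw [M.sum_P_congr hs' fun s' h => ih s' (by omega), gap, M.optQ_eq l hs']
      simp only [mul_add, Finset.sum_add_distrib]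
      ring
    simp only [polValue, h1, Finset.sum_add_distrib, ← Finset.sum_mul]
    rw [(π s).2.2, one_mul]

/-- The performance difference identity: the regret of a policy against the optimal value is the
expected sum of the gaps along an episode. -/
theorem pairing_occ_eq_optValue_add (π : Policy S A) (l : S → A → ℝ) :
    M.pairing l (M.occ π) = M.optValue l M.init + M.pairing (M.gap l) (M.occ π) := by
  rw [pairing_occ, pairing_occ,
    M.polValue_eq_optValue_add π l L M.init (by rw [layer_init, zero_add])]

theorem gap_nonneg (l : S → A → ℝ) (s : S) (a : A) : 0 ≤ M.gap l s a := by
  rw [gap, optValue_eq_iInf_optQ, sub_nonneg]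
  exact ciInf_le (Set.finite_range _).bddBelow a

theorem exists_gap_eq_zero [Nonempty A] (l : S → A → ℝ) (s : S) : ∃ a, M.gap l s a = 0 := by
  obtain ⟨a, ha⟩ := exists_eq_ciInf_of_finite (f := fun a => M.optQ l s a)
  refine ⟨a, ?_⟩
  rw [gap, optValue_eq_iInf_optQ, ← ha, sub_self]

theorem pairing_gap_nonneg (l : S → A → ℝ) (π : Policy S A) :
    0 ≤ M.pairing (M.gap l) (M.occ π) :=
  Finset.sum_nonneg fun s _ => Finset.sum_nonneg fun a _ =>
    mul_nonneg (M.gap_nonneg l s a) (M.occ_nonneg π s a)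

/-! ### Optimal policies and policies with one deviation. -/

open Classical in
/-- The policy that plays uniformly in the sets `B s`. -/
def uniformPolicy (B : S → Finset A) (hB : ∀ s, (B s).Nonempty) : Policy S A := fun s =>
  ⟨fun a => if a ∈ B s then ((B s).card : ℝ)⁻¹ else 0, by
    refine ⟨fun a => ?_, ?_⟩
    · dsimp only
      split_ifs <;> positivity
    · have : ((B s).card : ℝ) ≠ 0 := by exact_mod_cast (hB s).card_pos.ne'
      rw [Finset.sum_ite_mem, Finset.univ_inter, Finset.sum_const, nsmul_eq_mul,
        mul_inv_cancel₀ this]⟩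

theorem uniformPolicy_pos_iff (B : S → Finset A) (hB : ∀ s, (B s).Nonempty) (s : S) (a : A) :
    0 < (uniformPolicy B hB s).1 a ↔ a ∈ B s := by
  have : 0 < ((B s).card : ℝ)⁻¹ := inv_pos.2 (by exact_mod_cast (hB s).card_pos)
  simp only [uniformPolicy]
  split_ifs with h
  · simp [h, hB s]
  · simp [h]

theorem mem_of_occ_uniformPolicy_ne_zero (B : S → Finset A) (hB : ∀ s, (B s).Nonempty) {s : S}
    {a : A} (h : M.occ (uniformPolicy B hB) s a ≠ 0) : a ∈ B s := by
  obtain ⟨τ, k, hτ, rfl, rfl⟩ := M.exists_traj_of_occ_ne_zero h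
  exact (uniformPolicy_pos_iff B hB _ _).1 ((M.isPossible_of_trajProb_ne_zero hτ).2 k)

/-- A policy supported on zero-gap actions has no excess in the performance difference identity. -/
theorem exists_optimal_policy [Nonempty A] (l : S → A → ℝ) :
    ∃ π : Policy S A, M.pairing l (M.occ π) = M.optValue l M.init := by
  classical
  have hB : ∀ s, (Finset.univ.filter fun a => M.gap l s a = 0).Nonempty := fun s =>
    (M.exists_gap_eq_zero l s).imp fun a ha => by simpa using ha
  refine ⟨uniformPolicy _ hB, ?_⟩
  rw [pairing_occ_eq_optValue_add, add_eq_left]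
  refine Finset.sum_eq_zero fun s _ => Finset.sum_eq_zero fun a _ => ?_
  by_cases h : M.occ (uniformPolicy _ hB) s a = 0
  · rw [h, mul_zero]
  · have := M.mem_of_occ_uniformPolicy_ne_zero _ hB h
    rw [(Finset.mem_filter.1 this).2, zero_mul]

/-- A state of `S^*` is visited on a trajectory all of whose actions have gap zero. -/
theorem exists_traj_of_mem_optStates [Nonempty A] {l : S → A → ℝ} {s : S}
    (hs : s ∈ M.optStates l) :
    ∃ (τ : Trajectory S A L) (k : Fin L), M.IsPossible τ ∧ τ.1 k.castSucc = s ∧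
      ∀ j : Fin L, M.gap l (τ.1 j.castSucc) (τ.2 j) = 0 := by
  obtain ⟨-, q, ⟨⟨π, rfl⟩, hopt⟩, hpos⟩ := hs
  obtain ⟨π₀, hπ₀⟩ := M.exists_optimal_policy l
  -- Optimality annihilates a sum of nonnegative terms, so every pair with positive occupancy has
  -- gap zero.
  have h1 : M.pairing (M.gap l) (M.occ π) = 0 := by
    have h2 := hopt _ ⟨π₀, rfl⟩
    rw [hπ₀, pairing_occ_eq_optValue_add] at h2
    linarith [M.pairing_gap_nonneg l π]
  have h3 : ∀ s a, M.gap l s a * M.occ π s a = 0 := by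
    intro s a
    have hn := fun s a => mul_nonneg (M.gap_nonneg l s a) (M.occ_nonneg π s a)
    have h4 := (Finset.sum_eq_zero_iff_of_nonneg fun s _ =>
      Finset.sum_nonneg fun a _ => hn s a).1 h1 s (Finset.mem_univ s)
    exact (Finset.sum_eq_zero_iff_of_nonneg fun a _ => hn s a).1 h4 a (Finset.mem_univ a)
  obtain ⟨b, -, hb⟩ := Finset.exists_ne_zero_of_sum_ne_zero hpos.ne'
  obtain ⟨τ, k, hτ, hk, -⟩ := M.exists_traj_of_occ_ne_zero hb
  refine ⟨τ, k, (M.isPossible_of_trajProb_ne_zero hτ).1, hk, fun j => ?_⟩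
  have h5 : 0 < M.occ π (τ.1 j.castSucc) (τ.2 j) :=
    lt_of_lt_of_le (lt_of_le_of_ne (M.trajProb_nonneg π τ) hτ.symm) (M.trajProb_le_occ π τ j)
  exact (mul_eq_zero.1 (h3 _ _)).resolve_right h5.ne'

/-- For `s ∈ S^*` some policy plays `(s, a)` with positive probability, and no other pair of
positive gap. -/
theorem exists_policy_deviating [Nonempty A] {l : S → A → ℝ} {s : S} (hs : s ∈ M.optStates l)
    (a : A) : ∃ π : Policy S A, 0 < M.occ π s a ∧
      M.pairing l (M.occ π) = M.optValue l M.init + M.gap l s a * M.occ π s a := by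
  classical
  obtain ⟨τ, k, hτ, hk, hgap⟩ := M.exists_traj_of_mem_optStates hs
  let B : S → Finset A := fun s' =>
    Finset.univ.filter fun a' => M.gap l s' a' = 0 ∨ (s' = s ∧ a' = a)
  have hB : ∀ s', (B s').Nonempty := fun s' =>
    (M.exists_gap_eq_zero l s').imp fun a ha => by simp [B, ha]
  refine ⟨uniformPolicy B hB, ?_, ?_⟩
  · have hpos := M.trajProb_pos hτ (π := uniformPolicy B hB) fun j =>
      (uniformPolicy_pos_iff B hB _ _).2 (by simp [B, hgap j])
    have h1 := lt_of_lt_of_le hpos (M.trajProb_le_occ _ τ k)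
    rw [hk] at h1
    -- The zero-gap trajectory only shows that `s` is visited with the action `τ.2 k`;
    -- proportionality transfers the positivity to `a`.
    have h2 := M.occ_mul_comm (uniformPolicy B hB) s a (τ.2 k)
    have h3 : 0 < (uniformPolicy B hB s).1 a := (uniformPolicy_pos_iff B hB _ _).2 (by simp [B])
    have h4 : 0 < M.occ (uniformPolicy B hB) s a * (uniformPolicy B hB s).1 (τ.2 k) := by
      rw [h2]; positivity
    exact pos_of_mul_pos_left h4 ((uniformPolicy B hB s).2.1 _)
  · rw [pairing_occ_eq_optValue_add, add_right_inj, ← sum_sum_single s a (fun s' a' =>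
      M.gap l s' a' * M.occ (uniformPolicy B hB) s' a')]
    refine Finset.sum_congr rfl fun s' _ => Finset.sum_congr rfl fun a' _ => ?_
    by_cases h : M.occ (uniformPolicy B hB) s' a' = 0
    · simp [h]
    · rcases (Finset.mem_filter.1 (M.mem_of_occ_uniformPolicy_ne_zero B hB h)).2 with h1 | h1
      · simp [h1]
      · simp [single, h1]

/-! ### The range of the gaps on the optimal states. -/

/-- After a prefix of loss `u` that ends in `s`, the total loss is in `[lo, hi]` whatever the next
`n` steps are. -/
def TotalLossIn (l : S → A → ℝ) (lo hi : ℝ) : ℕ → S → ℝ → Prop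
  | 0, _, u => u ∈ Set.Icc lo hi
  | n + 1, s, u => ∀ a s', 0 < M.P s a s' → TotalLossIn l lo hi n s' (u + l s a)

theorem totalLossIn_of_forall_traj {l : S → A → ℝ} {lo hi : ℝ} : ∀ (n : ℕ) (s : S) (u : ℝ),
    (∀ τ : Trajectory S A n, τ.1 0 = s →
      (∀ k : Fin n, 0 < M.P (τ.1 k.castSucc) (τ.2 k) (τ.1 k.succ)) →
        u + pathLoss l τ ∈ Set.Icc lo hi) → M.TotalLossIn l lo hi n s u := by
  intro n
  induction n with
  | zero =>
    intro s u h
    simpa [pathLoss, TotalLossIn] using h (fun _ => s, Fin.elim0) rfl (fun k => k.elim0)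
  | succ n ih =>
    intro s u h a s' hP
    refine ih s' _ fun τ hτ hτP => ?_
    have := h (consTraj s a τ) rfl ?_
    · rwa [pathLoss_consTraj, ← add_assoc] at this
    · intro k
      refine Fin.cases ?_ (fun k => ?_) k
      · simpa [consTraj, hτ] using hP
      · simpa only [consTraj, ← Fin.succ_castSucc, Fin.cons_succ] using hτP k

/-- The witness is the loss of the prefix of `τ` before time `k`: every continuation of positive
transition probability completes it to a possible trajectory. -/
theorem exists_totalLossIn_of_isPossible {l : S → A → ℝ} {lo hi : ℝ}
    (h : ∀ τ : Trajectory S A L, M.IsPossible τ → pathLoss l τ ∈ Set.Icc lo hi)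
    {τ : Trajectory S A L} (hτ : M.IsPossible τ) (k : Fin (L + 1)) :
    ∃ u, M.TotalLossIn l lo hi (L - k) (τ.1 k) u := by
  induction k using Fin.induction with
  | zero =>
    refine ⟨0, M.totalLossIn_of_forall_traj L _ _ fun σ h1 h2 => ?_⟩
    rw [zero_add]
    exact h σ ⟨h1.trans hτ.1, h2⟩
  | succ k ih =>
    obtain ⟨u, hu⟩ := ih
    have h1 : L - (k.castSucc : ℕ) = (L - (k.succ : ℕ)) + 1 := by
      simp only [Fin.val_castSucc, Fin.val_succ]; omega
    rw [h1] at hu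
    exact ⟨_, hu (τ.2 k) _ (hτ.2 k)⟩

/-- The left side averages the values over next states, and an interval is convex. -/
theorem add_optQ_mem_Icc {l : S → A → ℝ} {lo hi u : ℝ} {s : S} {a : A} (hs : s ≠ M.terminal)
    (h : ∀ s', 0 < M.P s a s' → u + l s a + M.optValue l s' ∈ Set.Icc lo hi) :
    u + M.optQ l s a ∈ Set.Icc lo hi := by
  have e : u + M.optQ l s a = ∑ s', M.P s a s' * (u + l s a + M.optValue l s') := by
    simp only [M.optQ_eq l hs, mul_add, Finset.sum_add_distrib, ← Finset.sum_mul, M.P_sum s a hs]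
    ring
  have e2 : ∀ c : ℝ, c = ∑ s', M.P s a s' * c := fun c => by
    rw [← Finset.sum_mul, M.P_sum s a hs, one_mul]
  have hP : ∀ s', 0 = M.P s a s' ∨ 0 < M.P s a s' := fun s' => (M.P_mem s a s').1.eq_or_lt
  rw [e]
  constructor
  · rw [e2 lo]
    refine Finset.sum_le_sum fun s' _ => ?_
    rcases hP s' with h0 | h0
    · simp [← h0]
    · exact mul_le_mul_of_nonneg_left (h s' h0).1 h0.le
  · rw [e2 hi]
    refine Finset.sum_le_sum fun s' _ => ?_
    rcases hP s' with h0 | h0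
    · simp [← h0]
    · exact mul_le_mul_of_nonneg_left (h s' h0).2 h0.le

theorem TotalLossIn.add_optValue_mem [Nonempty A] {M : LayeredMDP S A L} {l : S → A → ℝ}
    {lo hi : ℝ} : ∀ {n : ℕ} {s : S} {u : ℝ}, M.TotalLossIn l lo hi n s u →
      (M.layer s : ℕ) + n = L → u + M.optValue l s ∈ Set.Icc lo hi := by
  intro n
  induction n with
  | zero =>
    intro s u h hs
    have : L - (M.layer s : ℕ) = 0 := by omega
    simpa [optValue, this, optValueAux, TotalLossIn] using h
  | succ n ih =>
    intro s u h hs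
    have hs' : s ≠ M.terminal := M.ne_terminal_of_layer_lt (by omega)
    obtain ⟨a, ha⟩ := M.exists_gap_eq_zero l s
    rw [← sub_eq_zero.1 ha]
    exact M.add_optQ_mem_Icc hs' fun s' hP => ih (h a s' hP)
      (by rw [M.layer_eq_of_P_ne_zero hs' hP.ne']; omega)

/-- On `S^*` the gaps are at most the range of the path losses. -/
theorem gap_le_of_mem_optStates [Nonempty A] {l : S → A → ℝ} {lo hi : ℝ}
    (h : ∀ τ : Trajectory S A L, M.IsPossible τ → pathLoss l τ ∈ Set.Icc lo hi) {s : S}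
    (hs : s ∈ M.optStates l) (a : A) : M.gap l s a ≤ hi - lo := by
  obtain ⟨τ, k, hτ, rfl, -⟩ := M.exists_traj_of_mem_optStates hs
  obtain ⟨u, hu⟩ := M.exists_totalLossIn_of_isPossible h hτ k.castSucc
  have hlay := hτ.layer_eq k.castSucc
  -- The same prefix loss `u` gives $u+V^*(s)\ge lo$ here and $u+Q^*(s,a)\le hi$ below; it cancels
  -- in the difference.
  have h1 := hu.add_optValue_mem (by rw [hlay]; simp only [Fin.val_castSucc]; omega)
  have h2 : L - (k.castSucc : ℕ) = (L - (k.castSucc : ℕ) - 1) + 1 := by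
    simp only [Fin.val_castSucc]; omega
  rw [h2] at hu
  have h3 := M.add_optQ_mem_Icc hs.1 fun s' hP => (hu a s' hP).add_optValue_mem
    (by rw [M.layer_eq_of_P_ne_zero hs.1 hP.ne', hlay]; simp only [Fin.val_castSucc]; omega)
  rw [gap]
  linarith [h1.1, h3.2]

/-! ### The lowered instance and its divergence from the original. -/

/-- The loss function `l` with the value at `(s, a)` lowered by `d`. -/
def lowerAt (l : S → A → ℝ) (s : S) (a : A) (d : ℝ) : S → A → ℝ :=
  fun s' a' => l s' a' - d * single s a s' a'

theorem pairing_lowerAt (l : S → A → ℝ) (s : S) (a : A) (d : ℝ) (q : S → A → ℝ) :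
    M.pairing (lowerAt l s a d) q = M.pairing l q - d * q s a := by
  rw [← M.pairing_single s a q]
  simp only [pairing, lowerAt, sub_mul, Finset.sum_sub_distrib, Finset.mul_sum, mul_assoc]

open Classical in
theorem IsPossible.pathLoss_single {M : LayeredMDP S A L} {τ : Trajectory S A L}
    (h : M.IsPossible τ) (s : S) (a : A) :
    pathLoss (single s a) τ = if ∃ k : Fin L, τ.1 k.castSucc = s ∧ τ.2 k = a then 1 else 0 := by
  rw [← h.sum_visits, ← sum_sum_single s a (fun s a =>
    if ∃ k : Fin L, τ.1 k.castSucc = s ∧ τ.2 k = a then (1 : ℝ) else 0)]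
  refine Finset.sum_congr rfl fun s' _ => Finset.sum_congr rfl fun a' _ => ?_
  split_ifs <;> simp

theorem pathLoss_lowerAt (l : S → A → ℝ) (s : S) (a : A) (d : ℝ) (τ : Trajectory S A L) :
    pathLoss (lowerAt l s a d) τ = pathLoss l τ - d * pathLoss (single s a) τ := by
  simp only [pathLoss, lowerAt, Finset.sum_sub_distrib, Finset.mul_sum]

/-- A possible trajectory meets `(s, a)` at most once, so it loses at most $5/16<3/8$. The interval
is open so that both feedback bits keep positive probability, which gives absolute continuity. -/
theorem IsPossible.pathLoss_lowerAt_mem {M : LayeredMDP S A L} {τ : Trajectory S A L}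
    (h : M.IsPossible τ) {l : S → A → ℝ} {s : S} {a : A} {d : ℝ}
    (hl : pathLoss l τ ∈ Set.Icc (3 / 8 : ℝ) (5 / 8)) (hd : d ∈ Set.Icc (0 : ℝ) (5 / 16)) :
    pathLoss (lowerAt l s a d) τ ∈ Set.Ioo (0 : ℝ) 1 := by
  classical
  obtain ⟨hl1, hl2⟩ := hl
  obtain ⟨hd1, hd2⟩ := hd
  rw [pathLoss_lowerAt, h.pathLoss_single]
  split_ifs <;> constructor <;> linarith

theorem isInstance_lowerAt {l : S → A → ℝ} (h01 : ∀ s a, l s a ∈ Set.Icc (0 : ℝ) 1)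
    (h0 : ∀ a, l M.terminal a = 0)
    (hl : ∀ τ : Trajectory S A L, M.IsPossible τ → pathLoss l τ ∈ Set.Icc (3 / 8 : ℝ) (5 / 8))
    {s : S} (hs : s ≠ M.terminal) (a : A) {d : ℝ} (hd : d ∈ Set.Icc (0 : ℝ) (5 / 16)) :
    M.IsInstance (lowerAt l s a d) := by
  classical
  refine ⟨fun s' a' => ?_, fun a' => ?_, fun τ hτ =>
    Set.Ioo_subset_Icc_self (hτ.pathLoss_lowerAt_mem (hl τ hτ) hd)⟩
  · obtain ⟨h1, h2⟩ := h01 s' a'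
    obtain ⟨hd1, hd2⟩ := hd
    simp only [lowerAt, single]
    split_ifs <;> constructor <;> linarith
  · simp [lowerAt, single, h0, hs.symm]

theorem outcomeProb_nonneg {l : S → A → ℝ} (h : M.IsInstance l) (π : Policy S A)
    (x : Outcome S A L) : 0 ≤ M.outcomeProb l π x := by
  unfold outcomeProb
  by_cases hx : M.trajProb π x.1 = 0
  · simp [hx]
  · have h1 := h.2.2 _ (M.isPossible_of_trajProb_ne_zero hx).1
    refine mul_nonneg (M.trajProb_nonneg π _) ?_
    split_ifs <;> linarith [h1.1, h1.2]

theorem sum_outcomeProb (l : S → A → ℝ) (π : Policy S A) :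
    ∑ x : Outcome S A L, M.outcomeProb l π x = 1 := by
  rw [Fintype.sum_prod_type, ← M.sum_trajProb π]
  refine Finset.sum_congr rfl fun τ _ => ?_
  simp only [outcomeProb, Fintype.sum_bool, if_true, Bool.false_eq_true, if_false]
  ring

theorem outcomeProb_lowerAt_pos {l : S → A → ℝ}
    (hl : ∀ τ : Trajectory S A L, M.IsPossible τ → pathLoss l τ ∈ Set.Icc (3 / 8 : ℝ) (5 / 8))
    (s : S) (a : A) {d : ℝ} (hd : d ∈ Set.Icc (0 : ℝ) (5 / 16)) {π : Policy S A}
    {x : Outcome S A L} (hx : 0 < M.outcomeProb l π x) :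
    0 < M.outcomeProb (lowerAt l s a d) π x := by
  have h1 : M.trajProb π x.1 ≠ 0 := fun h => by simp [outcomeProb, h] at hx
  have h2 := (M.isPossible_of_trajProb_ne_zero h1).1
  have h3 := h2.pathLoss_lowerAt_mem (s := s) (a := a) (hl _ h2) hd
  unfold outcomeProb
  refine mul_pos (lt_of_le_of_ne (M.trajProb_nonneg π _) h1.symm) ?_
  split_ifs <;> linarith [h3.1, h3.2]

/-- The divergence of the laws of one episode on two instances that differ at `(s, a)` only. -/
theorem sum_outcomeProb_mul_log_le {l : S → A → ℝ}
    (hl : ∀ τ : Trajectory S A L, M.IsPossible τ → pathLoss l τ ∈ Set.Icc (3 / 8 : ℝ) (5 / 8))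
    (s : S) (a : A) {d : ℝ} (hd : d ∈ Set.Icc (0 : ℝ) (1 / 4)) (π : Policy S A) :
    ∑ x : Outcome S A L, M.outcomeProb l π x *
        Real.log (M.outcomeProb l π x / M.outcomeProb (lowerAt l s a (5 / 4 * d)) π x) ≤
      27 * d ^ 2 * M.occ π s a := by
  classical
  rw [Fintype.sum_prod_type, occ, Finset.sum_filter, Finset.mul_sum]
  refine Finset.sum_le_sum fun τ _ => ?_
  simp only [outcomeProb, Fintype.sum_bool, if_true, Bool.false_eq_true, if_false]
  by_cases hτ : M.trajProb π τ = 0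
  · simp [hτ]
  have h1 := (M.isPossible_of_trajProb_ne_zero hτ).1
  rw [mul_div_mul_left _ _ hτ, mul_div_mul_left _ _ hτ, mul_assoc, mul_assoc, ← mul_add,
    pathLoss_lowerAt, h1.pathLoss_single]
  have hp := hl τ h1
  split_ifs with h
  · rw [mul_comm (27 * d ^ 2)]
    exact mul_le_mul_of_nonneg_left (bernoulli_kl_le hp hd.1 hd.2 (by ring))
      (M.trajProb_nonneg π τ)
  -- Off `(s, a)` the two feedback laws agree and both logarithms vanish.
  · rw [mul_zero, mul_zero, sub_zero, div_self (by linarith [hp.1]),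
      div_self (by linarith [hp.2])]
    simp

/-! ### Measurability, integrability and the regret of an algorithm. -/

variable {Ω : Type*} [MeasurableSpace Ω]

theorem measurable_trajProb (τ : Trajectory S A L) : Measurable fun π => M.trajProb π τ := by
  unfold trajProb
  split_ifs
  · refine Finset.measurable_prod _ fun k _ => Measurable.mul_const ?_ _
    exact (measurable_pi_apply _).comp (measurable_subtype_coe.comp (measurable_pi_apply _))
  · exact measurable_const

theorem measurable_occ (s : S) (a : A) : Measurable fun π => M.occ π s a :=
  Finset.measurable_sum _ fun τ _ => M.measurable_trajProb τ

theorem measurable_pairing_occ (f : S → A → ℝ) : Measurable fun π => M.pairing f (M.occ π) :=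
  Finset.measurable_sum _ fun s _ => Finset.measurable_sum _ fun a _ =>
    (M.measurable_occ s a).const_mul _

theorem measurable_histProb (l : S → A → ℝ) (alg : Algorithm Ω S A L) {T : ℕ}
    (h : Fin T → Outcome S A L) : Measurable fun ω => M.histProb l alg ω h := by
  refine Finset.measurable_prod _ fun t _ => Measurable.mul_const ?_ _
  exact (M.measurable_trajProb _).comp (alg.measurable_policy _ _)

theorem abs_pairing_occ_le (f : S → A → ℝ) (π : Policy S A) :
    |M.pairing f (M.occ π)| ≤ ∑ s, ∑ a, |f s a| := by
  refine (Finset.abs_sum_le_sum_abs _ _).trans (Finset.sum_le_sum fun s _ =>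
    (Finset.abs_sum_le_sum_abs _ _).trans (Finset.sum_le_sum fun a _ => ?_))
  rw [abs_mul, abs_of_nonneg (M.occ_nonneg π s a)]
  exact mul_le_of_le_one_right (abs_nonneg _) (M.occ_le_one π s a)

/-- The expectation, given the seed, of the sum of `f π_t` over the first `T` episodes. -/
def runSum (l : S → A → ℝ) (alg : Algorithm Ω S A L) (f : Policy S A → ℝ) (T : ℕ) (ω : Ω) : ℝ :=
  ∑ h : Fin T → Outcome S A L, M.histProb l alg ω h *
    ∑ t : Fin T, f (alg.policy t ω (past h t))

theorem histProb_nonneg {l : S → A → ℝ} (hl : M.IsInstance l) (alg : Algorithm Ω S A L) (ω : Ω)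
    {T : ℕ} (h : Fin T → Outcome S A L) : 0 ≤ M.histProb l alg ω h :=
  Finset.prod_nonneg fun _ _ => M.outcomeProb_nonneg hl _ _

theorem sum_histProb (l : S → A → ℝ) (alg : Algorithm Ω S A L) (ω : Ω) (T : ℕ) :
    ∑ h : Fin T → Outcome S A L, M.histProb l alg ω h = 1 :=
  sum_seqProb (fun t g x => M.outcomeProb l (alg.policy t ω g) x)
    (fun _ _ => M.sum_outcomeProb l _) T

theorem abs_runSum_le {l : S → A → ℝ} (hl : M.IsInstance l) (alg : Algorithm Ω S A L)
    {f : Policy S A → ℝ} {C : ℝ} (hf : ∀ π, |f π| ≤ C) (T : ℕ) (ω : Ω) :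
    |M.runSum l alg f T ω| ≤ T * C := by
  calc |M.runSum l alg f T ω| ≤ ∑ h : Fin T → Outcome S A L, M.histProb l alg ω h * (T * C) := by
        refine (Finset.abs_sum_le_sum_abs _ _).trans (Finset.sum_le_sum fun h _ => ?_)
        rw [abs_mul, abs_of_nonneg (M.histProb_nonneg hl alg ω h)]
        refine mul_le_mul_of_nonneg_left ?_ (M.histProb_nonneg hl alg ω h)
        refine (Finset.abs_sum_le_sum_abs _ _).trans ((Finset.sum_le_sum fun t _ => hf _).trans ?_)
        simp
    _ = T * C := by rw [← Finset.sum_mul, M.sum_histProb, one_mul]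

theorem integrable_runSum {l : S → A → ℝ} (hl : M.IsInstance l) (alg : Algorithm Ω S A L)
    {f : Policy S A → ℝ} {C : ℝ} (hf : ∀ π, |f π| ≤ C) (hm : Measurable f) (T : ℕ) :
    Integrable (M.runSum l alg f T) alg.seed := by
  have := alg.seed_prob
  refine Integrable.of_bound (C := T * C) (Measurable.aestronglyMeasurable ?_)
    (Eventually.of_forall fun ω => M.abs_runSum_le hl alg hf T ω)
  refine Finset.measurable_sum _ fun h _ => (M.measurable_histProb l alg h).mul ?_
  exact Finset.measurable_sum _ fun t _ => hm.comp (alg.measurable_policy _ _)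

theorem integrable_runSum_pairing {l : S → A → ℝ} (hl : M.IsInstance l) (alg : Algorithm Ω S A L)
    (f : S → A → ℝ) (T : ℕ) :
    Integrable (M.runSum l alg (fun π => M.pairing f (M.occ π)) T) alg.seed :=
  M.integrable_runSum hl alg (M.abs_pairing_occ_le f) (M.measurable_pairing_occ f) T

theorem integrable_runSum_occ {l : S → A → ℝ} (hl : M.IsInstance l) (alg : Algorithm Ω S A L)
    (s : S) (a : A) (T : ℕ) :
    Integrable (M.runSum l alg (fun π => M.occ π s a) T) alg.seed :=
  M.integrable_runSum hl alg (C := 1)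
    (fun π => by rw [abs_of_nonneg (M.occ_nonneg π s a)]; exact M.occ_le_one π s a)
    (M.measurable_occ s a) T

theorem runSum_mono {l : S → A → ℝ} (hl : M.IsInstance l) (alg : Algorithm Ω S A L)
    {f g : Policy S A → ℝ} (hfg : ∀ π, f π ≤ g π) (T : ℕ) (ω : Ω) :
    M.runSum l alg f T ω ≤ M.runSum l alg g T ω :=
  Finset.sum_le_sum fun h _ => mul_le_mul_of_nonneg_left
    (Finset.sum_le_sum fun _ _ => hfg _) (M.histProb_nonneg hl alg ω h)

theorem runSum_sum (l : S → A → ℝ) (alg : Algorithm Ω S A L) {ι : Type*} (I : Finset ι)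
    (w : ι → ℝ) (f : ι → Policy S A → ℝ) (T : ℕ) (ω : Ω) :
    M.runSum l alg (fun π => ∑ i ∈ I, w i * f i π) T ω =
      ∑ i ∈ I, w i * M.runSum l alg (f i) T ω := by
  simp only [runSum, Finset.mul_sum]
  rw [Finset.sum_comm (s := I)]
  refine Finset.sum_congr rfl fun h _ => ?_
  rw [Finset.sum_comm]
  exact Finset.sum_congr rfl fun i _ => Finset.sum_congr rfl fun t _ => by ring

/-- The regret dominates the expected sum of the gaps. -/
theorem integral_runSum_gap_le_regret [Nonempty A] {l : S → A → ℝ} (hl : M.IsInstance l)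
    (alg : Algorithm Ω S A L) (T : ℕ) :
    ∫ ω, M.runSum l alg (fun π => M.pairing (M.gap l) (M.occ π)) T ω ∂alg.seed ≤
      M.regret l alg T := by
  have := alg.seed_prob
  obtain ⟨π₀, hπ₀⟩ := M.exists_optimal_policy l
  have h1 : ∫ ω, M.runSum l alg (fun π => M.pairing (M.gap l) (M.occ π)) T ω ∂alg.seed =
      M.regretAgainst l alg π₀ T := by
    have : (fun π => M.pairing (M.gap l) (M.occ π)) =
        fun π => M.pairing l (M.occ π) - M.pairing l (M.occ π₀) := by
      funext π
      rw [hπ₀, M.pairing_occ_eq_optValue_add π l, add_sub_cancel_left]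
    rw [this]
    rfl
  rw [h1]
  -- The real supremum is meaningful only for a family bounded above, hence the crude bound linear
  -- in `T`.
  refine le_ciSup (f := fun π' => M.regretAgainst l alg π' T)
    ⟨T * (∑ s, ∑ a, |l s a| + ∑ s, ∑ a, |l s a|), ?_⟩ π₀
  rintro _ ⟨π', rfl⟩
  have h2 : ∀ π, |M.pairing l (M.occ π) - M.pairing l (M.occ π')| ≤
      ∑ s, ∑ a, |l s a| + ∑ s, ∑ a, |l s a| := fun π =>
    (abs_sub _ _).trans (add_le_add (M.abs_pairing_occ_le l π) (M.abs_pairing_occ_le l π'))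
  have h3 := norm_integral_le_of_norm_le_const (μ := alg.seed) (f := M.runSum l alg _ T)
    (Eventually.of_forall fun ω => M.abs_runSum_le hl alg h2 T ω)
  rw [probReal_univ, mul_one] at h3
  exact (le_abs_self _).trans h3

/-! ### The logarithmic lower bound. -/

section LowerBound

variable {M} {l : S → A → ℝ}

theorem IsInstance.of_pathLoss_mem (h01 : ∀ s a, l s a ∈ Set.Icc (0 : ℝ) 1)
    (h0 : ∀ a, l M.terminal a = 0)
    (hl : ∀ τ : Trajectory S A L, M.IsPossible τ → pathLoss l τ ∈ Set.Icc (3 / 8 : ℝ) (5 / 8)) :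
    M.IsInstance l :=
  ⟨fun s a => ⟨by linarith [(h01 s a).1], (h01 s a).2⟩, h0, fun τ hτ =>
    ⟨by linarith [(hl τ hτ).1], by linarith [(hl τ hτ).2]⟩⟩

/-- On the instance lowered at `(s, a)`, a policy that seldom plays `(s, a)` is suboptimal. -/
theorem exists_le_occ_add_gap_lowerAt [Nonempty A] {s : S} (hs : s ∈ M.optStates l) {a : A}
    (ha : 0 < M.gap l s a) : ∃ p > 0, ∀ π : Policy S A, p ≤ M.occ π s a + 4 / M.gap l s a *
      M.pairing (M.gap (lowerAt l s a (5 / 4 * M.gap l s a))) (M.occ π) := by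
  obtain ⟨π', hp, hπ'⟩ := M.exists_policy_deviating hs a
  refine ⟨_, hp, fun π => ?_⟩
  set d := M.gap l s a
  set l' := lowerAt l s a (5 / 4 * d)
  have h1 := M.pairing_lowerAt l s a (5 / 4 * d) (M.occ π)
  have h2 := M.pairing_lowerAt l s a (5 / 4 * d) (M.occ π')
  rw [hπ'] at h2
  have h3 := M.pairing_occ_eq_optValue_add π l'
  have h4 := M.pairing_occ_eq_optValue_add π' l'
  have h5 := M.pairing_occ_eq_optValue_add π l
  have h6 : d * M.occ π s a ≤ M.pairing (M.gap l) (M.occ π) := by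
    have hn := fun s a => mul_nonneg (M.gap_nonneg l s a) (M.occ_nonneg π s a)
    calc d * M.occ π s a ≤ ∑ a, M.gap l s a * M.occ π s a :=
          Finset.single_le_sum (f := fun a => M.gap l s a * M.occ π s a)
            (fun a _ => hn s a) (Finset.mem_univ a)
      _ ≤ _ := Finset.single_le_sum (f := fun s => ∑ a, M.gap l s a * M.occ π s a)
            (fun s _ => Finset.sum_nonneg fun a _ => hn s a) (Finset.mem_univ s)
  have h7 := M.pairing_gap_nonneg l' π'
  -- On `l'`, `π'` has value $V^*-\frac d4q^{\pi'}(s,a)$, which bounds the new optimum above, while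
  -- `π` has value at least $V^*-\frac d4q^\pi(s,a)$.
  have h8 : d / 4 * (M.occ π' s a - M.occ π s a) ≤ M.pairing (M.gap l') (M.occ π) := by
    linarith
  have h9 : M.occ π' s a - M.occ π s a =
      4 / d * (d / 4 * (M.occ π' s a - M.occ π s a)) := by field_simp
  have h10 := mul_le_mul_of_nonneg_left h8 (show 0 ≤ 4 / d by positivity)
  linarith

/-- The change of measure, given the seed. -/
theorem exp_neg_runSum_le [Nonempty A] (h01 : ∀ s a, l s a ∈ Set.Icc (0 : ℝ) 1)
    (h0 : ∀ a, l M.terminal a = 0)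
    (hl : ∀ τ : Trajectory S A L, M.IsPossible τ → pathLoss l τ ∈ Set.Icc (3 / 8 : ℝ) (5 / 8))
    {s : S} (hs : s ∈ M.optStates l) {a : A} (ha : 0 < M.gap l s a) {p : ℝ} (hp : 0 < p)
    (hpπ : ∀ π : Policy S A, p ≤ M.occ π s a + 4 / M.gap l s a *
      M.pairing (M.gap (lowerAt l s a (5 / 4 * M.gap l s a))) (M.occ π))
    (alg : Algorithm Ω S A L) (T : ℕ) (ω : Ω) :
    T * p / 2 * Real.exp (-(27 * M.gap l s a ^ 2 *
        M.runSum l alg (fun π => M.occ π s a) T ω)) ≤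
      M.runSum l alg (fun π => M.occ π s a) T ω + 4 / M.gap l s a *
        M.runSum (lowerAt l s a (5 / 4 * M.gap l s a)) alg (fun π =>
          M.pairing (M.gap (lowerAt l s a (5 / 4 * M.gap l s a))) (M.occ π)) T ω := by
  have hd : M.gap l s a ≤ 1 / 4 := (M.gap_le_of_mem_optStates hl hs a).trans (by norm_num)
  set d := M.gap l s a
  have hd' : 5 / 4 * d ∈ Set.Icc (0 : ℝ) (5 / 16) := ⟨by positivity, by linarith⟩
  set l' := lowerAt l s a (5 / 4 * d)
  have hI : M.IsInstance l := .of_pathLoss_mem h01 h0 hl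
  have hI' : M.IsInstance l' := M.isInstance_lowerAt h01 h0 hl hs.1 a hd'
  have h1 := exp_neg_le_two_mul_sum_min_seqProb
    (fun t g x => M.outcomeProb l (alg.policy t ω g) x)
    (fun t g x => M.outcomeProb l' (alg.policy t ω g) x)
    (fun t g x => M.outcomeProb_nonneg hI _ _) (fun t g x => M.outcomeProb_nonneg hI' _ _)
    (fun t g => M.sum_outcomeProb _ _) (fun t g => M.sum_outcomeProb _ _)
    (fun t g x hx => M.outcomeProb_lowerAt_pos hl s a hd' hx)
    (fun t g => 27 * d ^ 2 * M.occ (alg.policy t ω g) s a)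
    (fun t g => M.sum_outcomeProb_mul_log_le hl s a ⟨ha.le, hd⟩ _) T
  have h2 : ∑ h : Fin T → Outcome S A L,
      seqProb (fun t g x => M.outcomeProb l (alg.policy t ω g) x) h *
        ∑ t : Fin T, 27 * d ^ 2 * M.occ (alg.policy t ω (past h t)) s a =
      27 * d ^ 2 * M.runSum l alg (fun π => M.occ π s a) T ω := by
    rw [runSum, Finset.mul_sum]
    refine Finset.sum_congr rfl fun h _ => ?_
    rw [← Finset.mul_sum, mul_left_comm]
    rfl
  rw [h2] at h1
  change _ ≤ 2 * ∑ h : Fin T → Outcome S A L,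
    min (M.histProb l alg ω h) (M.histProb l' alg ω h) at h1
  -- Given the history, both instances prescribe the same policy. The bound on `p` is weighted by
  -- the minimum of the two laws, which is then relaxed to the law of `l` for the occupancy and to
  -- that of `l'` for the regret.
  have h3 : T * p * ∑ h : Fin T → Outcome S A L,
      min (M.histProb l alg ω h) (M.histProb l' alg ω h) ≤
      M.runSum l alg (fun π => M.occ π s a) T ω + 4 / d *
        M.runSum l' alg (fun π => M.pairing (M.gap l') (M.occ π)) T ω := by
    rw [runSum, runSum, Finset.mul_sum, Finset.mul_sum, ← Finset.sum_add_distrib]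
    refine Finset.sum_le_sum fun h _ => ?_
    have e : T * p * min (M.histProb l alg ω h) (M.histProb l' alg ω h) =
        ∑ t : Fin T, min (M.histProb l alg ω h) (M.histProb l' alg ω h) * p := by
      simp; ring
    rw [e, mul_left_comm, Finset.mul_sum, Finset.mul_sum, Finset.mul_sum,
      ← Finset.sum_add_distrib]
    refine Finset.sum_le_sum fun t _ => ?_
    set π := alg.policy t ω (past h t)
    have hm : 0 ≤ min (M.histProb l alg ω h) (M.histProb l' alg ω h) :=
      le_min (M.histProb_nonneg hI alg ω h) (M.histProb_nonneg hI' alg ω h)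
    have hg : 0 ≤ 4 / d * M.pairing (M.gap l') (M.occ π) :=
      mul_nonneg (by positivity) (M.pairing_gap_nonneg l' π)
    calc _ ≤ min (M.histProb l alg ω h) (M.histProb l' alg ω h) *
          (M.occ π s a + 4 / d * M.pairing (M.gap l') (M.occ π)) :=
          mul_le_mul_of_nonneg_left (hpπ π) hm
      _ = min (M.histProb l alg ω h) (M.histProb l' alg ω h) * M.occ π s a +
          min (M.histProb l alg ω h) (M.histProb l' alg ω h) *
            (4 / d * M.pairing (M.gap l') (M.occ π)) := mul_add _ _ _
      _ ≤ M.histProb l alg ω h * M.occ π s a +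
          M.histProb l' alg ω h * (4 / d * M.pairing (M.gap l') (M.occ π)) :=
          add_le_add (mul_le_mul_of_nonneg_right (min_le_left _ _) (M.occ_nonneg π s a))
            (mul_le_mul_of_nonneg_right (min_le_right _ _) hg)
      _ = _ := by ring
  have h4 := mul_le_mul_of_nonneg_left h1 (show 0 ≤ T * p / 2 by positivity)
  linarith

/-- The expected number of plays of a suboptimal pair at a state of `S^*`. -/
theorem exists_log_le_integral_runSum_occ [Nonempty A] {alg : ℕ → Algorithm Ω S A L} {ε : ℝ}
    (hc : M.IsConsistent alg ε) (h01 : ∀ s a, l s a ∈ Set.Icc (0 : ℝ) 1)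
    (h0 : ∀ a, l M.terminal a = 0)
    (hl : ∀ τ : Trajectory S A L, M.IsPossible τ → pathLoss l τ ∈ Set.Icc (3 / 8 : ℝ) (5 / 8))
    {s : S} (hs : s ∈ M.optStates l) {a : A} (ha : 0 < M.gap l s a) :
    ∃ B : ℝ, ∀ T : ℕ, 1 ≤ T → (ε * Real.log T - B) / (27 * M.gap l s a) ≤
      M.gap l s a * ∫ ω, M.runSum l (alg T) (fun π => M.occ π s a) T ω ∂(alg T).seed := by
  have hd : M.gap l s a ≤ 1 / 4 := (M.gap_le_of_mem_optStates hl hs a).trans (by norm_num)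
  have hI : M.IsInstance l := .of_pathLoss_mem h01 h0 hl
  obtain ⟨p, hp, hpπ⟩ := exists_le_occ_add_gap_lowerAt hs ha
  have key := fun (T : ℕ) => exp_neg_runSum_le h01 h0 hl hs ha hp hpπ (alg T) T
  set d := M.gap l s a
  set l' := lowerAt l s a (5 / 4 * d)
  have hI' : M.IsInstance l' :=
    M.isInstance_lowerAt h01 h0 hl hs.1 a ⟨by positivity, by linarith⟩
  obtain ⟨C, hC, hCT⟩ := hc l hI
  obtain ⟨C', hC', hCT'⟩ := hc l' hI'
  -- Chosen so that $\frac{Tp}{2}DT^{-\epsilon}$ is the consistency bound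
  -- $(C/d+4C'/d)T^{1-\epsilon}$. All its ingredients are fixed before `T`, even though the
  -- algorithm may vary with `T`.
  set D := (C / d + 4 / d * C') * (2 / p)
  have hD : 0 < D := by positivity
  refine ⟨Real.log D, fun T hT => ?_⟩
  have := (alg T).seed_prob
  set X := M.runSum l (alg T) (fun π => M.occ π s a) T
  set R := M.runSum l' (alg T) (fun π => M.pairing (M.gap l') (M.occ π)) T
  have iX : Integrable X (alg T).seed := M.integrable_runSum_occ hI (alg T) s a T
  have iR : Integrable R (alg T).seed := M.integrable_runSum_pairing hI' (alg T) (M.gap l') T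
  set EX := ∫ ω, X ω ∂(alg T).seed
  have hT0 : (0 : ℝ) < T := by exact_mod_cast hT
  have hR : ∫ ω, R ω ∂(alg T).seed ≤ C' * (T : ℝ) ^ (1 - ε) :=
    (M.integral_runSum_gap_le_regret hI' (alg T) T).trans (hCT' T)
  have hX : EX ≤ C / d * (T : ℝ) ^ (1 - ε) := by
    have h1 : d * EX ≤ C * (T : ℝ) ^ (1 - ε) := by
      refine le_trans ?_ ((M.integral_runSum_gap_le_regret hI (alg T) T).trans (hCT T))
      rw [← integral_const_mul]
      refine integral_mono (iX.const_mul d) (M.integrable_runSum_pairing hI (alg T) _ T)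
        fun ω => ?_
      have h2 := M.runSum_sum l (alg T) {()} (fun _ => d) (fun _ π => M.occ π s a) T ω
      simp only [Finset.sum_singleton] at h2
      change d * X ω ≤ _
      rw [← h2]
      refine M.runSum_mono hI (alg T) (fun π => ?_) T ω
      rw [← sum_sum_single s a (fun s a => M.gap l s a * M.occ π s a)]
      refine Finset.sum_le_sum fun s' _ => Finset.sum_le_sum fun a' _ => ?_
      refine mul_le_of_le_one_left (mul_nonneg (M.gap_nonneg l s' a') (M.occ_nonneg π s' a')) ?_
      unfold single
      split_ifs <;> norm_num
    rw [div_mul_eq_mul_div, le_div_iff₀ ha]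
    linarith
  have hint : T * p / 2 * Real.exp (-(27 * d ^ 2 * EX)) ≤
      EX + 4 / d * ∫ ω, R ω ∂(alg T).seed := by
    -- Jensen over the seed, through the tangent of $e^{-y}$ at the mean `m`; the linear term
    -- integrates to one.
    set m := 27 * d ^ 2 * EX with hm
    have h1 : ∀ ω, T * p / 2 * (Real.exp (-m) * (1 + m - 27 * d ^ 2 * X ω)) ≤
        X ω + 4 / d * R ω := by
      intro ω
      refine le_trans (mul_le_mul_of_nonneg_left ?_ (by positivity)) (key T ω)
      calc _ ≤ Real.exp (-m) * Real.exp (m - 27 * d ^ 2 * X ω) :=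
            mul_le_mul_of_nonneg_left
              (by linarith [Real.add_one_le_exp (m - 27 * d ^ 2 * X ω)]) (Real.exp_pos _).le
        _ = _ := by rw [← Real.exp_add]; ring_nf; rfl
    have i1 : Integrable (fun ω => 1 + m - 27 * d ^ 2 * X ω) (alg T).seed :=
      (integrable_const _).sub (iX.const_mul _)
    have h2 := integral_mono ((i1.const_mul (Real.exp (-m))).const_mul (T * p / 2))
      (iX.add (iR.const_mul (4 / d))) h1
    simp only [Pi.add_apply] at h2
    rw [integral_const_mul, integral_const_mul, integral_add iX (iR.const_mul (4 / d)),
      integral_const_mul, integral_sub (integrable_const _) (iX.const_mul _),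
      integral_const_mul, integral_const, probReal_univ, one_smul, ← hm, add_sub_cancel_right,
      mul_one] at h2
    exact h2
  have hexp : Real.exp (-(27 * d ^ 2 * EX)) ≤ D * (T : ℝ) ^ (-ε) := by
    have h1 : T * p / 2 * Real.exp (-(27 * d ^ 2 * EX)) ≤
        (C / d + 4 / d * C') * (T : ℝ) ^ (1 - ε) := by
      have := mul_le_mul_of_nonneg_left hR (show 0 ≤ 4 / d by positivity)
      linarith
    have h2 : (T : ℝ) ^ (1 - ε) = T * (T : ℝ) ^ (-ε) := by
      rw [sub_eq_add_neg, Real.rpow_add hT0, Real.rpow_one]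
    rw [h2] at h1
    have h3 : T * p / 2 * (D * (T : ℝ) ^ (-ε)) =
        (C / d + 4 / d * C') * (T * (T : ℝ) ^ (-ε)) := by
      simp only [D]
      field_simp
    rw [← h3] at h1
    exact le_of_mul_le_mul_left h1 (by positivity)
  have hlog := Real.log_le_log (Real.exp_pos _) hexp
  rw [Real.log_exp, Real.log_mul hD.ne' (Real.rpow_pos_of_pos hT0 _).ne', Real.log_rpow hT0] at hlog
  rw [div_le_iff₀ (by positivity)]
  linarith

-- The gap-weighted expected play counts sum to a lower bound for the regret, so the bounds for
-- single pairs add; the pairs left out contribute nonnegative terms.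
open Classical in
theorem exists_log_le_regret [Nonempty A] {alg : ℕ → Algorithm Ω S A L} {ε : ℝ}
    (hc : M.IsConsistent alg ε) (h01 : ∀ s a, l s a ∈ Set.Icc (0 : ℝ) 1)
    (h0 : ∀ a, l M.terminal a = 0)
    (hl : ∀ τ : Trajectory S A L, M.IsPossible τ → pathLoss l τ ∈ Set.Icc (3 / 8 : ℝ) (5 / 8)) :
    ∃ B : ℝ, ∀ T : ℕ, 1 ≤ T → 1 / 27 * ε * (∑ s : S with s ∈ M.optStates l,
      ∑ a : A with 0 < M.gap l s a, 1 / M.gap l s a) * Real.log T - B ≤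
        M.regret l (alg T) T := by
  have hI : M.IsInstance l := .of_pathLoss_mem h01 h0 hl
  have h1 : ∀ s a, ∃ B : ℝ, s ∈ M.optStates l → 0 < M.gap l s a → ∀ T : ℕ, 1 ≤ T →
      (ε * Real.log T - B) / (27 * M.gap l s a) ≤ M.gap l s a *
        ∫ ω, M.runSum l (alg T) (fun π => M.occ π s a) T ω ∂(alg T).seed := by
    intro s a
    by_cases h : s ∈ M.optStates l ∧ 0 < M.gap l s a
    · obtain ⟨B, hB⟩ := exists_log_le_integral_runSum_occ hc h01 h0 hl h.1 h.2
      exact ⟨B, fun _ _ => hB⟩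
    · exact ⟨0, fun h1 h2 => absurd ⟨h1, h2⟩ h⟩
  choose B hB using h1
  refine ⟨∑ s : S with s ∈ M.optStates l, ∑ a : A with 0 < M.gap l s a,
    B s a / (27 * M.gap l s a), fun T hT => ?_⟩
  have := (alg T).seed_prob
  refine le_trans ?_ (M.integral_runSum_gap_le_regret hI (alg T) T)
  have h2 : ∀ ω, M.runSum l (alg T) (fun π => M.pairing (M.gap l) (M.occ π)) T ω =
      ∑ x : S × A, M.gap l x.1 x.2 * M.runSum l (alg T) (fun π => M.occ π x.1 x.2) T ω := by
    intro ω
    rw [← M.runSum_sum]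
    simp only [pairing, Fintype.sum_prod_type]
  simp only [h2]
  rw [integral_finsetSum _ fun x _ => (M.integrable_runSum_occ hI (alg T) x.1 x.2 T).const_mul _]
  simp only [integral_const_mul, Fintype.sum_prod_type]
  have hn : ∀ s a, 0 ≤ M.gap l s a *
      ∫ ω, M.runSum l (alg T) (fun π => M.occ π s a) T ω ∂(alg T).seed := fun s a =>
    mul_nonneg (M.gap_nonneg l s a) (integral_nonneg fun ω => Finset.sum_nonneg fun h _ =>
      mul_nonneg (M.histProb_nonneg hI _ ω h) (Finset.sum_nonneg fun t _ => M.occ_nonneg _ s a))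
  calc _ = ∑ s : S with s ∈ M.optStates l, ∑ a : A with 0 < M.gap l s a,
        (ε * Real.log T - B s a) / (27 * M.gap l s a) := by
        rw [mul_right_comm, Finset.mul_sum, ← Finset.sum_sub_distrib]
        refine Finset.sum_congr rfl fun s _ => ?_
        rw [Finset.mul_sum, ← Finset.sum_sub_distrib]
        refine Finset.sum_congr rfl fun a ha => ?_
        have := (Finset.mem_filter.1 ha).2
        field_simp
    _ ≤ ∑ s : S with s ∈ M.optStates l, ∑ a : A with 0 < M.gap l s a, M.gap l s a *
        ∫ ω, M.runSum l (alg T) (fun π => M.occ π s a) T ω ∂(alg T).seed :=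
        Finset.sum_le_sum fun s hs => Finset.sum_le_sum fun a ha =>
          hB s a (Finset.mem_filter.1 hs).2 (Finset.mem_filter.1 ha).2 T hT
    _ ≤ ∑ s : S with s ∈ M.optStates l, ∑ a, M.gap l s a *
        ∫ ω, M.runSum l (alg T) (fun π => M.occ π s a) T ω ∂(alg T).seed :=
        Finset.sum_le_sum fun s _ =>
          Finset.sum_le_sum_of_subset_of_nonneg (Finset.filter_subset _ _) fun a _ _ => hn s a
    _ ≤ _ := Finset.sum_le_sum_of_subset_of_nonneg (Finset.filter_subset _ _)
        fun s _ _ => Finset.sum_nonneg fun a _ => hn s a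

end LowerBound

end LayeredMDP

end

end AggregateMDP

/-! ### Passage to the limit. -/

open Classical in
theorem mainTheorem2 :
    ∃ c : ℝ, 0 < c ∧
      ∀ (Ω S A : Type*) [MeasurableSpace Ω] [Fintype S] [Fintype A] (L : ℕ)
        (M : AggregateMDP.LayeredMDP S A L) (alg : ℕ → AggregateMDP.Algorithm Ω S A L)
        (ε : ℝ), ε ∈ Set.Ioo (0 : ℝ) 1 → M.IsConsistent alg ε →
      ∀ l : S → A → ℝ,
        (∀ s a, l s a ∈ Set.Icc (0 : ℝ) 1) →
        (∀ a, l M.terminal a = 0) →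
        (∀ τ : AggregateMDP.Trajectory S A L, M.IsPossible τ →
          AggregateMDP.pathLoss l τ ∈ Set.Icc (3 / 8 : ℝ) (5 / 8)) →
        ((c * ε * ∑ s : S with s ∈ M.optStates l, ∑ a : A with 0 < M.gap l s a,
            1 / M.gap l s a : ℝ) : EReal) ≤
          Filter.liminf (fun T : ℕ => ((M.regret l (alg T) T / Real.log T : ℝ) : EReal))
            Filter.atTop := by
  refine ⟨1 / 27, by norm_num, ?_⟩
  intro Ω S A _ _ _ L M alg ε _ hc l h01 h0 hl
  -- The seed space is nonempty and the algorithm names a policy at the initial state; with no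
  -- actions the probabilities would sum to zero.
  have hA : Nonempty A := by
    have := (alg 0).seed_prob
    obtain ⟨ω⟩ := nonempty_of_isProbabilityMeasure (alg 0).seed
    by_contra h
    rw [not_nonempty_iff] at h
    have h1 := ((alg 0).policy 0 ω Fin.elim0 M.init).2.2
    simp at h1
  obtain ⟨B, hB⟩ := AggregateMDP.LayeredMDP.exists_log_le_regret hc h01 h0 hl
  set G := ∑ s : S with s ∈ M.optStates l, ∑ a : A with 0 < M.gap l s a, 1 / M.gap l s a
  have hlog : Tendsto (fun T : ℕ => Real.log T) atTop atTop :=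
    Real.tendsto_log_atTop.comp tendsto_natCast_atTop_atTop
  have h1 : Tendsto (fun T : ℕ => 1 / 27 * ε * G - B / Real.log T) atTop
      (nhds (1 / 27 * ε * G)) := by
    simpa using tendsto_const_nhds.sub (hlog.const_div_atTop B)
  have h2 : Tendsto (fun T : ℕ => ((1 / 27 * ε * G - B / Real.log T : ℝ) : EReal)) atTop
      (nhds ((1 / 27 * ε * G : ℝ) : EReal)) :=
    (continuous_coe_real_ereal.tendsto _).comp h1
  -- The constant is rewritten as the liminf of a sequence that is eventually below the normalized
  -- regret.
  rw [← h2.liminf_eq]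
  refine liminf_le_liminf ?_
  filter_upwards [eventually_ge_atTop 1, hlog.eventually_gt_atTop 0] with T hT hT'
  rw [EReal.coe_le_coe_iff, le_div_iff₀ hT', sub_mul, div_mul_cancel₀ _ hT'.ne']
  exact hB T hT
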